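/- Let $n\ge 0$ and $\pm[n]=\{-n,\dots,-1,1,\dots,n\}$; in $\mathbb{R}^n$ put $e_{-i}=-e_i$. A hypercube graph $G$ is a graph on $\pm[n]$ with no edge $\{i,-i\}$. A tube of $G$ is a nonempty set $t\subseteq\pm[n]$ that contains no pair $\{i,-i\}$ and induces a connected subgraph; a tubing is a set $T$ of tubes such that any two of them are nested, or disjoint with no edge of $G$ between them, and such that $\bigcup T$ contains no pair $\{i,-i\}$. Put $v_t=\sum_{i\in t}e_i$. Let $\mathcal{F}(Q_n,V,G)$ be the collection of the cones $\operatorname{Cone}\{v_t : t\in T\}$ over all tubings $T$. A standard cut hypercube graph associahedron of $G$ is a full-dimensional simple polyhedron in $\mathbb{R}^n$ whose dual simplicial complex is isomorphic to the complex of tubings of $G$ and whose normal fan equals $\mathcal{F}(Q_n,V,G)$. The single path hypercube graph has edges $\{i,i+1\}$ for $1\le i<n$ and no others. In type $A_n$, let $\alpha_i=e_i-e_{i+1}\in\mathbb{R}^{n+1}$ be the simple roots, $s_i=(i\ \,i+1)$ the simple reflections, and $[\beta:\alpha_i]$ the coefficient of $\alpha_i$ in the expansion of $\beta$ in simple roots.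 The almost positive roots are the positive roots and the $-\alpha_i$. Let $\sigma_i$ fix $-\alpha_j$ for $j\ne i$ and act as $s_i$ on all other almost positive roots. A Coxeter element is a product of $s_1,\dots,s_n$, each taken once, in some order; $s_i$ is initial in $c$ if some reduced word of $c$ starts with $s_i$. **Proposition.** There is a unique family of symmetric relations $\parallel_c$ on the almost positive roots, one for each Coxeter element $c$, such that (1) $-\alpha_i\parallel_c\beta$ if and only if $[\beta:\alpha_i]=0$, and (2) if $s_i$ is initial in $c$, then $\beta\parallel_c\gamma$ if and only if $\sigma_i(\beta)\parallel_{s_ics_i}\sigma_i(\gamma)$. Let the $c$-cluster fan consist of the cones $\operatorname{Cone}(S)$ over all sets $S$ of almost positive roots whose distinct elements are pairwise $\parallel_c$-related. Then, for the linear Coxeter element $c=s_1s_2\cdots s_n$, the linear isomorphism from $\mathbb{R}^n$ onto the span of the roots with $e_i\mapsto\alpha_i$ for all $i\in[n]$ carries the fan $\mathcal{F}(Q_n,V,G)$ of the single path hypercube graph $G$ onto the $c$-cluster fan of type $A_n$. In particular, it carries the normal fan of every standard cut $n$-dimensional single path hypercube graph associahedron onto the linear $c$-cluster fan of type $A_n$.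 -/

import Mathlib

/-! ### Cones, polyhedra and normal fans -/

/-- The conic hull `Cone S`: all finite nonnegative combinations of elements of `S`
(in particular `Cone ∅ = {0}`). -/
def conicHull {E : Type*} [AddCommGroup E] [Module ℝ E] (S : Set E) : Set E :=
  (Submodule.span NNReal S : Set E)

/-- A polyhedron in `ℝⁿ`: the solution set of finitely many weak linear inequalities. -/
def IsPolyhedron {n : ℕ} (P : Set (Fin n → ℝ)) : Prop :=
  ∃ (m : ℕ) (c : Fin m → Fin n → ℝ) (b : Fin m → ℝ), P = {x | ∀ k, c k ⬝ᵥ x ≤ b k}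

/-- The set of points of `P` at which the linear functional `x ↦ v · x` is maximal on `P`. -/
def maxFace {n : ℕ} (P : Set (Fin n → ℝ)) (v : Fin n → ℝ) : Set (Fin n → ℝ) :=
  {x | x ∈ P ∧ ∀ y ∈ P, v ⬝ᵥ y ≤ v ⬝ᵥ x}

/-- The nonempty faces of `P` (including `P` itself, for `v = 0`). -/
def IsFace {n : ℕ} (P F : Set (Fin n → ℝ)) : Prop :=
  F.Nonempty ∧ ∃ v, F = maxFace P v

/-- The normal cone of a face `F` of `P`. -/
def normalCone {n : ℕ} (P F : Set (Fin n → ℝ)) : Set (Fin n → ℝ) :=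
  {v | F ⊆ maxFace P v}

/-- The normal fan of `P`: the normal cones of all nonempty faces of `P`. -/
def normalFan {n : ℕ} (P : Set (Fin n → ℝ)) : Set (Set (Fin n → ℝ)) :=
  {C | ∃ F, IsFace P F ∧ C = normalCone P F}

/-- The dimension of (the affine hull of) a nonempty set. -/
noncomputable def affineDim {n : ℕ} (F : Set (Fin n → ℝ)) : ℕ :=
  Module.finrank ℝ (affineSpan ℝ F).direction

/-- The facets of a full-dimensional polyhedron `P` in `ℝⁿ`: its faces of dimension `n - 1`. -/
def facets {n : ℕ} (P : Set (Fin n → ℝ)) : Set (Set (Fin n → ℝ)) :=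
  {F | IsFace P F ∧ affineDim F + 1 = n}

/-- A full-dimensional simple polyhedron in `ℝⁿ`: every nonempty face of codimension `d` is
contained in exactly `d` facets. -/
def IsSimplePolyhedron {n : ℕ} (P : Set (Fin n → ℝ)) : Prop :=
  IsPolyhedron P ∧ affineSpan ℝ P = ⊤ ∧
    ∀ F, IsFace P F → {A | A ∈ facets P ∧ F ⊆ A}.encard + (affineDim F : ℕ∞) = (n : ℕ∞)

/-- The faces of the dual simplicial complex of `P`, a complex on the set of facets of `P`:
the sets of facets with nonempty intersection (the empty set of facets having intersection `P`). -/
def IsDualFace {n : ℕ} (P : Set (Fin n → ℝ)) (X : Set (facets P)) : Prop :=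
  ∃ x ∈ P, ∀ A ∈ X, x ∈ (A : Set (Fin n → ℝ))

/-- The image of a collection of cones under a linear map. -/
def mapFan {E E' : Type*} [AddCommGroup E] [Module ℝ E] [AddCommGroup E'] [Module ℝ E']
    (f : E →ₗ[ℝ] E') (𝓕 : Set (Set E)) : Set (Set E') :=
  {D | ∃ C ∈ 𝓕, D = f '' C}

/-! ### Hypercube graphs, tubes and tubings -/

/-- The index set `±[n]`: `Sum.inl i` stands for the positive index `i` and `Sum.inr i` for
`-i`; negation is `Sum.swap`. -/
abbrev SignedIndex (n : ℕ) : Type := Fin n ⊕ Fin n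

/-- The outer facet normals `e_i`, `e_{-i} = -e_i` of the standard hypercube. -/
def cubeNormal {n : ℕ} : SignedIndex n → (Fin n → ℝ)
  | Sum.inl i => Pi.single i 1
  | Sum.inr i => -Pi.single i 1

/-- The faces of the dual simplicial complex of the `n`-cube: the sets of indices that contain
no pair `{i, -i}`. -/
def IsCubeFace {n : ℕ} (t : Finset (SignedIndex n)) : Prop :=
  ∀ a ∈ t, a.swap ∉ t

/-- An `n`-dimensional hypercube graph: a graph on `±[n]` whose edges are faces of the dual
complex of the cube, that is, without edges `{i, -i}`. -/
structure HypercubeGraph (n : ℕ) where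
  graph : SimpleGraph (SignedIndex n)
  not_adj_swap : ∀ a, ¬ graph.Adj a a.swap

/-- A tube: a face that induces a connected (in particular nonempty) subgraph. -/
def IsTube {n : ℕ} (G : HypercubeGraph n) (t : Finset (SignedIndex n)) : Prop :=
  IsCubeFace t ∧ (G.graph.induce (t : Set (SignedIndex n))).Connected

/-- Weak compatibility of two tubes. -/
def WeaklyCompatible {n : ℕ} (G : HypercubeGraph n) (t u : Finset (SignedIndex n)) : Prop :=
  t ⊆ u ∨ u ⊆ t ∨ (Disjoint t u ∧ ∀ a ∈ t, ∀ b ∈ u, ¬ G.graph.Adj a b)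

/-- A tubing: a set of pairwise weakly compatible tubes whose union is a face of the dual complex
of the cube. -/
def IsTubing {n : ℕ} (G : HypercubeGraph n) (T : Finset (Finset (SignedIndex n))) : Prop :=
  (∀ t ∈ T, IsTube G t) ∧ (∀ t ∈ T, ∀ u ∈ T, WeaklyCompatible G t u) ∧ IsCubeFace (T.sup id)

/-- The vector `v_t = ∑_{i ∈ t} e_i` of a tube. -/
def tubeVector {n : ℕ} (t : Finset (SignedIndex n)) : Fin n → ℝ :=
  ∑ a ∈ t, cubeNormal a

/-- The nested fan of `G` over the normal fan of the standard cube: the cones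
`Cone {v_t | t ∈ T}` for all tubings `T`. -/
def tubingFan {n : ℕ} (G : HypercubeGraph n) : Set (Set (Fin n → ℝ)) :=
  {C | ∃ T : Finset (Finset (SignedIndex n)),
    IsTubing G T ∧ C = conicHull (tubeVector '' (T : Set (Finset (SignedIndex n))))}

/-- A hypercube graph associahedron of `G`: a simple polyhedron in `ℝⁿ` whose dual simplicial
complex is isomorphic to the complex of tubings of `G` (whose vertices are the tubes). -/
def IsHypercubeGraphAssociahedron {n : ℕ} (G : HypercubeGraph n) (P : Set (Fin n → ℝ)) : Prop :=
  IsSimplePolyhedron P ∧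
    ∃ e : {t : Finset (SignedIndex n) // IsTube G t} ≃ facets P,
      ∀ T : Finset {t : Finset (SignedIndex n) // IsTube G t},
        IsTubing G (T.map (Function.Embedding.subtype _)) ↔
          IsDualFace P (e '' (T : Set {t : Finset (SignedIndex n) // IsTube G t}))

/-- A standard cut hypercube graph associahedron of `G`. -/
def IsStandardCutAssociahedron {n : ℕ} (G : HypercubeGraph n) (P : Set (Fin n → ℝ)) : Prop :=
  IsHypercubeGraphAssociahedron G P ∧ normalFan P = tubingFan G

/-- The single path hypercube graph: the path `1, 2, …, n` on the positive indices, and no other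
edges. -/
def singlePath (n : ℕ) : HypercubeGraph n where
  graph :=
    { Adj := fun a b => ∃ i j : Fin n, a = Sum.inl i ∧ b = Sum.inl j ∧
        (i.val + 1 = j.val ∨ j.val + 1 = i.val)
      symm := ⟨by
        rintro a b ⟨i, j, ha, hb, h⟩
        exact ⟨j, i, hb, ha, h.symm⟩⟩
      loopless := ⟨by
        rintro a ⟨i, j, ha, hb, h⟩
        have hij : i = j := Sum.inl_injective (ha.symm.trans hb)
        subst hij
        omega⟩ }
  not_adj_swap := by
    rintro a ⟨i, j, ha, hb, _⟩
    subst ha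
    simp at hb

/-! ### The root system of type `A_n`, Coxeter elements and cluster fans -/

/-- The simple root `α_i = e_i - e_{i+1}` in `ℝ^{n+1}`. -/
def simpleRoot {n : ℕ} (i : Fin n) : Fin (n + 1) → ℝ :=
  Pi.single i.castSucc 1 - Pi.single i.succ 1

/-- The roots `e_i - e_j`, `i ≠ j`, of the root system of type `A_n`. -/
def roots (n : ℕ) : Set (Fin (n + 1) → ℝ) :=
  {β | ∃ i j : Fin (n + 1), i ≠ j ∧ β = Pi.single i 1 - Pi.single j 1}

/-- The `n`-dimensional linear span of the root system of type `A_n`. -/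
def rootSpace (n : ℕ) : Submodule ℝ (Fin (n + 1) → ℝ) :=
  Submodule.span ℝ (roots n)

/-- The almost positive roots: the roots that are nonnegative combinations of simple roots,
together with the negatives of the simple roots. -/
def almostPositiveRoots (n : ℕ) : Set (Fin (n + 1) → ℝ) :=
  {β | β ∈ roots n ∧
    ((∃ a : Fin n → ℝ, (∀ i, 0 ≤ a i) ∧ β = ∑ i, a i • simpleRoot i) ∨
      ∃ i : Fin n, β = -simpleRoot i)}

/-- The simple reflection `s_i = (i i+1)` of the Coxeter group of type `A_n`, realized as the
group of permutations of `n + 1` letters. -/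
def simpleReflection {n : ℕ} (i : Fin n) : Equiv.Perm (Fin (n + 1)) :=
  Equiv.swap i.castSucc i.succ

/-- The action of a permutation on `ℝ^{n+1}` by permuting coordinates, `w e_i = e_{w i}`. -/
def permAct {n : ℕ} (w : Equiv.Perm (Fin (n + 1))) (x : Fin (n + 1) → ℝ) : Fin (n + 1) → ℝ :=
  fun k => x (w⁻¹ k)

/-- The product `s_{i_1} ⋯ s_{i_k}` of a word in the simple reflections. -/
def wordProd {n : ℕ} (ω : List (Fin n)) : Equiv.Perm (Fin (n + 1)) :=
  (ω.map simpleReflection).prod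

/-- `ω` is a reduced word for `c`: a word for `c` of minimal length. -/
def IsReducedWordFor {n : ℕ} (ω : List (Fin n)) (c : Equiv.Perm (Fin (n + 1))) : Prop :=
  wordProd ω = c ∧ ∀ ω' : List (Fin n), wordProd ω' = c → ω.length ≤ ω'.length

/-- `s_i` is initial in `c`: some reduced word for `c` starts with `s_i`. -/
def IsInitialIn {n : ℕ} (i : Fin n) (c : Equiv.Perm (Fin (n + 1))) : Prop :=
  ∃ ω : List (Fin n), IsReducedWordFor (i :: ω) c

/-- A Coxeter element: a product of all simple reflections, each taken once, in some order. -/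
def IsCoxeterElement {n : ℕ} (c : Equiv.Perm (Fin (n + 1))) : Prop :=
  ∃ w : Equiv.Perm (Fin n), c = wordProd (List.ofFn w)

/-- The linear Coxeter element `s_1 s_2 ⋯ s_n`. -/
def linearCoxeterElement (n : ℕ) : Equiv.Perm (Fin (n + 1)) :=
  wordProd (List.finRange n)

open Classical in
/-- The operation `σ_i` on almost positive roots: it fixes `-α_j` for `j ≠ i` and is `s_i` on all
other almost positive roots. -/
noncomputable def sigmaOp {n : ℕ} (i : Fin n) (β : Fin (n + 1) → ℝ) : Fin (n + 1) → ℝ :=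
  if ∃ j : Fin n, j ≠ i ∧ β = -simpleRoot j then β else permAct (simpleReflection i) β

/-- The properties that define the family of `c`-compatibility relations, where
`R c β γ` reads `β ∥_c γ`. The relations are relations between almost positive roots, one for each
Coxeter element `c`; in `neg_simple` the right hand side says that the coefficient `[β : α_i]` of
`α_i` in the expansion of `β` in the (linearly independent) simple roots is zero. -/
structure IsCompatibilityFamily (n : ℕ)
    (R : Equiv.Perm (Fin (n + 1)) → (Fin (n + 1) → ℝ) → (Fin (n + 1) → ℝ) → Prop) : Prop where
  supported : ∀ c β γ, R c β γ →
    IsCoxeterElement c ∧ β ∈ almostPositiveRoots n ∧ γ ∈ almostPositiveRoots n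
  symmetric : ∀ c β γ, R c β γ → R c γ β
  neg_simple : ∀ c, IsCoxeterElement c → ∀ i : Fin n, ∀ β ∈ almostPositiveRoots n,
    (R c (-simpleRoot i) β ↔ ∃ a : Fin n → ℝ, β = ∑ j, a j • simpleRoot j ∧ a i = 0)
  initial_step : ∀ c, IsCoxeterElement c → ∀ i : Fin n, IsInitialIn i c →
    ∀ β ∈ almostPositiveRoots n, ∀ γ ∈ almostPositiveRoots n,
      (R c β γ ↔ R (simpleReflection i * c * simpleReflection i) (sigmaOp i β) (sigmaOp i γ))

/-- `c`-compatibility `β ∥_c γ`: the relation belonging to `c` in the family with the properties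
`IsCompatibilityFamily`. (That there is exactly one such family is part of the theorem.) -/
def CCompatible {n : ℕ} (c : Equiv.Perm (Fin (n + 1))) (β γ : Fin (n + 1) → ℝ) : Prop :=
  ∃ R, IsCompatibilityFamily n R ∧ R c β γ

/-- The `c`-cluster fan of type `A_n`: the cones spanned by the sets of pairwise `c`-compatible
almost positive roots (pairs of distinct roots, as no root is compatible with itself). -/
def clusterFan {n : ℕ} (c : Equiv.Perm (Fin (n + 1))) : Set (Set (Fin (n + 1) → ℝ)) :=
  {C | ∃ S : Finset (Fin (n + 1) → ℝ), (∀ β ∈ S, β ∈ almostPositiveRoots n) ∧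
    (∀ β ∈ S, ∀ γ ∈ S, β ≠ γ → CCompatible c β γ) ∧ C = conicHull (S : Set (Fin (n + 1) → ℝ))}

/-! ### Permutation action, fundamental weights and positive roots -/

/-! Existence comes from a closed formula. Each almost positive root can be written `γ = u - c u`,
and `β ⬝ᵥ u` is then a well-defined Euler form of `c`. Positive roots are declared compatible when
they are distinct and the form is nonnegative in both orders. Conjugating `c` by `s_i` transports
the form along `s_i`, so property (2) is formal away from `±α_i` and the other `-α_j`. At `±α_i` it
follows from `α_i = ω_i - c ω_i` for initial `s_i`, where `ω_i` is the fundamental weight, because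
positive roots have nonnegative coefficients (`eulerCompatible_iff_sigmaOp`).

For uniqueness, apply (2) cyclically along a word of `c`. If `β` ever becomes a negative simple
root, (1) decides its relation. Otherwise its whole `c`-orbit is positive, which is impossible
because the orbit sum of `v - c v` vanishes (`compatibilityDetermined`).

For the linear `c`, `α_k = e_k - c e_k`, so the form on interval sums of simple roots is explicit.
It is nonnegative both ways exactly when the intervals are nested or separated by a gap, which is
the condition on tubes of a path. The tubes `{-i}` correspond to `-α_i`. Both fans are defined by
pairwise conditions, so the match on pairs (`IsTube.eulerCompatible_iff`) gives equality of the
fans. -/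

theorem permAct_one {n : ℕ} (x : Fin (n + 1) → ℝ) : permAct 1 x = x := rfl

theorem permAct_mul {n : ℕ} (w w' : Equiv.Perm (Fin (n + 1))) (x : Fin (n + 1) → ℝ) :
    permAct (w * w') x = permAct w (permAct w' x) := by
  funext k
  simp [permAct]

theorem permAct_sub {n : ℕ} (w : Equiv.Perm (Fin (n + 1))) (x y : Fin (n + 1) → ℝ) :
    permAct w (x - y) = permAct w x - permAct w y := rfl

theorem permAct_neg {n : ℕ} (w : Equiv.Perm (Fin (n + 1))) (x : Fin (n + 1) → ℝ) :
    permAct w (-x) = -permAct w x := rfl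

theorem permAct_smul {n : ℕ} (w : Equiv.Perm (Fin (n + 1))) (r : ℝ) (x : Fin (n + 1) → ℝ) :
    permAct w (r • x) = r • permAct w x := rfl

theorem permAct_sum {n : ℕ} {ι : Type*} (w : Equiv.Perm (Fin (n + 1))) (s : Finset ι)
    (f : ι → Fin (n + 1) → ℝ) : permAct w (∑ i ∈ s, f i) = ∑ i ∈ s, permAct w (f i) := by
  funext k
  simp [permAct]

theorem permAct_single {n : ℕ} (w : Equiv.Perm (Fin (n + 1))) (a : Fin (n + 1)) :
    permAct w (Pi.single a 1) = Pi.single (w a) 1 := by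
  funext k
  simp only [permAct, Pi.single_apply, Equiv.Perm.inv_eq_iff_eq]

theorem permAct_dotProduct {n : ℕ} (w : Equiv.Perm (Fin (n + 1))) (x y : Fin (n + 1) → ℝ) :
    permAct w x ⬝ᵥ permAct w y = x ⬝ᵥ y :=
  Equiv.sum_comp w⁻¹ fun k => x k * y k

theorem permAct_inv_permAct {n : ℕ} (w : Equiv.Perm (Fin (n + 1))) (x : Fin (n + 1) → ℝ) :
    permAct w⁻¹ (permAct w x) = x := by
  rw [← permAct_mul, inv_mul_cancel, permAct_one]

theorem simpleRoot_dotProduct {n : ℕ} (i : Fin n) (x : Fin (n + 1) → ℝ) :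
    simpleRoot i ⬝ᵥ x = x i.castSucc - x i.succ := by
  simp [simpleRoot, sub_dotProduct]

theorem permAct_simpleReflection {n : ℕ} (i : Fin n) (x : Fin (n + 1) → ℝ) :
    permAct (simpleReflection i) x = x - (simpleRoot i ⬝ᵥ x) • simpleRoot i := by
  have hne : i.castSucc ≠ i.succ := Fin.castSucc_lt_succ.ne
  rw [simpleRoot_dotProduct]
  funext k
  by_cases h1 : k = i.castSucc
  · subst h1
    simp [permAct, simpleReflection, simpleRoot, hne]
  by_cases h2 : k = i.succ
  · subst h2
    simp [permAct, simpleReflection, simpleRoot, hne.symm]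
  · simp [permAct, simpleReflection, simpleRoot, h1, h2, Equiv.swap_apply_of_ne_of_ne]

theorem simpleReflection_mul_self {n : ℕ} (i : Fin n) :
    simpleReflection i * simpleReflection i = 1 :=
  Equiv.swap_mul_self _ _

theorem simpleReflection_inv {n : ℕ} (i : Fin n) :
    (simpleReflection i)⁻¹ = simpleReflection i :=
  Equiv.swap_inv _ _

theorem permAct_simpleReflection_self {n : ℕ} (i : Fin n) :
    permAct (simpleReflection i) (simpleRoot i) = -simpleRoot i := by
  simp [simpleRoot, permAct_sub, permAct_single, simpleReflection]

/-- The `i`-th fundamental weight, whose pairing with a vector in the span of the simple roots is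
the coefficient of `α_i`. -/
def weight {n : ℕ} (i : Fin n) : Fin (n + 1) → ℝ := fun k => if k ≤ i.castSucc then 1 else 0

/-- The indicator of an initial segment drops at one place only. The weights are thus dual to the
simple roots, and pairing with them replaces coefficient extraction throughout. -/
theorem simpleRoot_dotProduct_weight {n : ℕ} (i j : Fin n) :
    simpleRoot j ⬝ᵥ weight i = if j = i then 1 else 0 := by
  rw [simpleRoot_dotProduct]
  simp only [weight, Fin.le_def, Fin.ext_iff, Fin.val_castSucc, Fin.val_succ]
  split_ifs <;> first | omega | norm_num

theorem sum_smul_simpleRoot_dotProduct_weight {n : ℕ} (a : Fin n → ℝ) (i : Fin n) :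
    (∑ j, a j • simpleRoot j) ⬝ᵥ weight i = a i := by
  simp [sum_dotProduct, simpleRoot_dotProduct_weight]

theorem permAct_simpleReflection_weight_of_ne {n : ℕ} {i j : Fin n} (h : j ≠ i) :
    permAct (simpleReflection j) (weight i) = weight i := by
  simp [permAct_simpleReflection, simpleRoot_dotProduct_weight, h]

theorem permAct_simpleReflection_weight {n : ℕ} (i : Fin n) :
    permAct (simpleReflection i) (weight i) = weight i - simpleRoot i := by
  simp [permAct_simpleReflection, simpleRoot_dotProduct_weight]

theorem permAct_simpleReflection_dotProduct_weight_of_ne {n : ℕ} {i j : Fin n} (h : j ≠ i)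
    (x : Fin (n + 1) → ℝ) : permAct (simpleReflection j) x ⬝ᵥ weight i = x ⬝ᵥ weight i := by
  rw [← permAct_simpleReflection_weight_of_ne h, permAct_dotProduct,
    permAct_simpleReflection_weight_of_ne h]

/-- The vectors `e_a - e_b` with `a < b`. -/
def IsPositiveRoot {n : ℕ} (β : Fin (n + 1) → ℝ) : Prop :=
  ∃ a b : Fin (n + 1), a < b ∧ β = Pi.single a 1 - Pi.single b 1

theorem isPositiveRoot_simpleRoot {n : ℕ} (i : Fin n) : IsPositiveRoot (simpleRoot i) :=
  ⟨_, _, Fin.castSucc_lt_succ, rfl⟩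

theorem single_sub_single_dotProduct_weight {n : ℕ} (a b : Fin (n + 1)) (i : Fin n) :
    ((Pi.single a 1 - Pi.single b 1 : Fin (n + 1) → ℝ)) ⬝ᵥ weight i =
      (if a ≤ i.castSucc then 1 else 0) - (if b ≤ i.castSucc then 1 else 0) := by
  simp [sub_dotProduct, weight]

theorem IsPositiveRoot.weight_nonneg {n : ℕ} {β : Fin (n + 1) → ℝ} (h : IsPositiveRoot β)
    (i : Fin n) : 0 ≤ β ⬝ᵥ weight i := by
  obtain ⟨a, b, hab, rfl⟩ := h
  rw [single_sub_single_dotProduct_weight]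
  split_ifs with h1 h2
  · norm_num
  · norm_num
  · exact absurd (hab.le.trans ‹_›) h1
  · norm_num

theorem IsPositiveRoot.exists_weight_eq_one {n : ℕ} {β : Fin (n + 1) → ℝ}
    (h : IsPositiveRoot β) : ∃ i : Fin n, β ⬝ᵥ weight i = 1 := by
  obtain ⟨a, b, hab, rfl⟩ := h
  have ha : a.val < n := by omega
  refine ⟨⟨a, ha⟩, ?_⟩
  have h2 : ¬ b ≤ a := not_le.2 hab
  rw [single_sub_single_dotProduct_weight]
  simp [h2]

theorem IsPositiveRoot.ne_neg_simpleRoot {n : ℕ} {β : Fin (n + 1) → ℝ}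
    (h : IsPositiveRoot β) (i : Fin n) : β ≠ -simpleRoot i := by
  rintro rfl
  have := h.weight_nonneg i
  rw [neg_dotProduct, simpleRoot_dotProduct_weight] at this
  norm_num at this

/-- An adjacent transposition reverses the order of no pair except the one it swaps. -/
theorem IsPositiveRoot.permAct_simpleReflection {n : ℕ} {β : Fin (n + 1) → ℝ}
    (h : IsPositiveRoot β) {i : Fin n} (hi : β ≠ simpleRoot i) :
    IsPositiveRoot (permAct (simpleReflection i) β) := by
  obtain ⟨a, b, hab, rfl⟩ := h
  refine ⟨simpleReflection i a, simpleReflection i b, ?_, by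
    rw [permAct_sub, permAct_single, permAct_single]⟩
  have hne : ¬ (a = i.castSucc ∧ b = i.succ) := by
    rintro ⟨rfl, rfl⟩
    exact hi rfl
  simp only [simpleReflection, Equiv.swap_apply_def]
  simp only [Fin.ext_iff, Fin.val_castSucc, Fin.val_succ] at hne ⊢
  rw [Fin.lt_def] at hab ⊢
  split_ifs <;> (try simp only [Fin.val_castSucc, Fin.val_succ]) <;> omega

/-! ### Positive roots as interval sums of simple roots -/

theorem sum_Icc_castSucc_sub_succ {n : ℕ} {M : Type*} [AddCommGroup M] (f : Fin (n + 1) → M)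
    {a b : Fin n} (h : a ≤ b) :
    ∑ k ∈ Finset.Icc a b, (f k.castSucc - f k.succ) = f a.castSucc - f b.succ := by
  -- Extending to `ℕ` gives access to the telescoping lemma; the default `0` is never read, since
  -- all indices are at most `n`.
  let g : ℕ → M := fun m => if hm : m < n + 1 then f ⟨m, hm⟩ else 0
  have hg : ∀ k : Fin n, f k.castSucc - f k.succ = -(g (k.val + 1) - g k.val) := by
    intro k
    have h1 : k.val < n + 1 := by omega
    simp only [g, dif_pos h1, dif_pos (Nat.succ_lt_succ k.isLt), neg_sub]
    rfl
  have hs : ∑ k ∈ Finset.Icc a b, (f k.castSucc - f k.succ) =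
      ∑ m ∈ Finset.Ico a.val (b.val + 1), -(g (m + 1) - g m) := by
    have : Finset.Ico a.val (b.val + 1) = (Finset.Icc a b).map Fin.valEmbedding := by
      rw [Fin.map_valEmbedding_Icc]; rfl
    rw [this, Finset.sum_map]
    exact Finset.sum_congr rfl fun k _ => hg k
  have h1 : a.val < n + 1 := by omega
  rw [hs, Finset.sum_neg_distrib, Finset.sum_Ico_sub g (by omega), neg_sub]
  simp only [g, dif_pos h1, dif_pos (Nat.succ_lt_succ b.isLt)]
  rfl

theorem sum_Icc_simpleRoot {n : ℕ} {a b : Fin n} (h : a ≤ b) :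
    ∑ k ∈ Finset.Icc a b, simpleRoot k = Pi.single a.castSucc 1 - Pi.single b.succ 1 :=
  sum_Icc_castSucc_sub_succ (fun k => Pi.single k (1 : ℝ)) h

theorem isPositiveRoot_iff_exists_Icc {n : ℕ} {β : Fin (n + 1) → ℝ} :
    IsPositiveRoot β ↔ ∃ a b : Fin n, a ≤ b ∧ β = ∑ k ∈ Finset.Icc a b, simpleRoot k := by
  constructor
  · rintro ⟨a, b, hab, rfl⟩
    rw [Fin.lt_def] at hab
    have hle : (⟨a, by omega⟩ : Fin n) ≤ ⟨b - 1, by omega⟩ := by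
      rw [Fin.le_def]; dsimp only; omega
    refine ⟨_, _, hle, ?_⟩
    rw [sum_Icc_simpleRoot hle]
    congr 2
    ext
    simp only [Fin.val_succ]
    omega
  · rintro ⟨a, b, hab, rfl⟩
    refine ⟨a.castSucc, b.succ, ?_, sum_Icc_simpleRoot hab⟩
    rw [Fin.lt_def, Fin.val_castSucc, Fin.val_succ]
    rw [Fin.le_def] at hab
    omega

theorem IsPositiveRoot.exists_nonneg_coeff {n : ℕ} {β : Fin (n + 1) → ℝ}
    (h : IsPositiveRoot β) :
    ∃ a : Fin n → ℝ, (∀ i, 0 ≤ a i) ∧ β = ∑ i, a i • simpleRoot i := by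
  obtain ⟨a, b, -, rfl⟩ := isPositiveRoot_iff_exists_Icc.1 h
  refine ⟨fun k => if k ∈ Finset.Icc a b then 1 else 0, fun i => ?_, ?_⟩
  · dsimp only
    split_ifs <;> norm_num
  · simp only [ite_smul, one_smul, zero_smul, Finset.sum_ite_mem, Finset.univ_inter]

theorem mem_almostPositiveRoots_iff {n : ℕ} {β : Fin (n + 1) → ℝ} :
    β ∈ almostPositiveRoots n ↔ IsPositiveRoot β ∨ ∃ i : Fin n, β = -simpleRoot i := by
  constructor
  · rintro ⟨⟨i, j, hij, hβ⟩, ⟨a, ha, hβa⟩ | h⟩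
    · refine Or.inl ?_
      rcases lt_or_gt_of_ne hij with hlt | hlt
      · exact ⟨i, j, hlt, hβ⟩
      -- For `j < i` the coefficient of `e_i - e_j` at `α_j` is `-1`.
      · exfalso
        have hj : j.val < n := by omega
        have h1 := sum_smul_simpleRoot_dotProduct_weight a ⟨j, hj⟩
        rw [← hβa, hβ, single_sub_single_dotProduct_weight] at h1
        have h2 : ¬ i ≤ j := not_le.2 hlt
        simp [h2] at h1
        have := ha ⟨j, hj⟩
        linarith
    · exact Or.inr h
  · rintro (h | ⟨i, rfl⟩)
    · refine ⟨?_, Or.inl h.exists_nonneg_coeff⟩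
      obtain ⟨a, b, hab, rfl⟩ := h
      exact ⟨a, b, hab.ne, rfl⟩
    · exact ⟨⟨i.succ, i.castSucc, Fin.castSucc_lt_succ.ne', by simp [simpleRoot]⟩,
        Or.inr ⟨i, rfl⟩⟩

theorem exists_coeff_of_mem_almostPositiveRoots {n : ℕ} {β : Fin (n + 1) → ℝ}
    (h : β ∈ almostPositiveRoots n) : ∃ a : Fin n → ℝ, β = ∑ i, a i • simpleRoot i := by
  obtain h | ⟨i, rfl⟩ := mem_almostPositiveRoots_iff.1 h
  · exact h.exists_nonneg_coeff.imp fun a ha => ha.2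
  · refine ⟨fun j => if j = i then -1 else 0, ?_⟩
    simp

theorem exists_coeff_eq_zero_iff {n : ℕ} {β : Fin (n + 1) → ℝ}
    (h : β ∈ almostPositiveRoots n) (i : Fin n) :
    (∃ a : Fin n → ℝ, β = ∑ j, a j • simpleRoot j ∧ a i = 0) ↔ β ⬝ᵥ weight i = 0 := by
  constructor
  · rintro ⟨a, rfl, ha⟩
    rw [sum_smul_simpleRoot_dotProduct_weight, ha]
  · intro h0
    obtain ⟨a, rfl⟩ := exists_coeff_of_mem_almostPositiveRoots h
    exact ⟨a, rfl, by rwa [sum_smul_simpleRoot_dotProduct_weight] at h0⟩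

theorem simpleRoot_injective {n : ℕ} : Function.Injective (simpleRoot (n := n)) := by
  intro i j h
  by_contra hij
  have := simpleRoot_dotProduct_weight j i
  rw [h, simpleRoot_dotProduct_weight] at this
  simp [hij] at this

/-! ### The operations `σ_i` on almost positive roots -/

theorem sigmaOp_neg_simpleRoot_of_ne {n : ℕ} {i j : Fin n} (h : j ≠ i) :
    sigmaOp i (-simpleRoot j) = -simpleRoot j :=
  if_pos ⟨j, h, rfl⟩

theorem sigmaOp_neg_simpleRoot_self {n : ℕ} (i : Fin n) :
    sigmaOp i (-simpleRoot i) = simpleRoot i := by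
  rw [sigmaOp, if_neg, permAct_neg, permAct_simpleReflection_self, neg_neg]
  rintro ⟨j, hj, h⟩
  exact hj (simpleRoot_injective (neg_injective h)).symm

theorem IsPositiveRoot.sigmaOp_eq {n : ℕ} {β : Fin (n + 1) → ℝ} (h : IsPositiveRoot β)
    (i : Fin n) : sigmaOp i β = permAct (simpleReflection i) β :=
  if_neg fun ⟨j, _, hj⟩ => h.ne_neg_simpleRoot j hj

theorem sigmaOp_simpleRoot {n : ℕ} (i : Fin n) : sigmaOp i (simpleRoot i) = -simpleRoot i := by
  rw [(isPositiveRoot_simpleRoot i).sigmaOp_eq, permAct_simpleReflection_self]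

theorem neg_simpleRoot_mem {n : ℕ} (i : Fin n) : -simpleRoot i ∈ almostPositiveRoots n :=
  mem_almostPositiveRoots_iff.2 (Or.inr ⟨i, rfl⟩)

theorem IsPositiveRoot.mem {n : ℕ} {β : Fin (n + 1) → ℝ} (h : IsPositiveRoot β) :
    β ∈ almostPositiveRoots n :=
  mem_almostPositiveRoots_iff.2 (Or.inl h)

theorem sigmaOp_mem {n : ℕ} (i : Fin n) {β : Fin (n + 1) → ℝ} (h : β ∈ almostPositiveRoots n) :
    sigmaOp i β ∈ almostPositiveRoots n := by
  obtain h | ⟨j, rfl⟩ := mem_almostPositiveRoots_iff.1 h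
  · by_cases hi : β = simpleRoot i
    · rw [hi, sigmaOp_simpleRoot]
      exact neg_simpleRoot_mem i
    · rw [h.sigmaOp_eq]
      exact (h.permAct_simpleReflection hi).mem
  · by_cases hj : j = i
    · rw [hj, sigmaOp_neg_simpleRoot_self]
      exact (isPositiveRoot_simpleRoot i).mem
    · rw [sigmaOp_neg_simpleRoot_of_ne hj]
      exact neg_simpleRoot_mem j

/-! ### Words for Coxeter elements -/

/-- Words in which every simple reflection occurs exactly once. -/
def IsCoxeterWord {n : ℕ} (ω : List (Fin n)) : Prop :=
  ω.Nodup ∧ ∀ i, i ∈ ω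

theorem IsCoxeterWord.length_eq {n : ℕ} {ω : List (Fin n)} (h : IsCoxeterWord ω) :
    ω.length = n := by
  rw [← List.toFinset_card_of_nodup h.1]
  have : ω.toFinset = Finset.univ := Finset.eq_univ_iff_forall.2 fun i => by simp [h.2 i]
  rw [this, Finset.card_univ, Fintype.card_fin]

theorem isCoxeterElement_iff {n : ℕ} {c : Equiv.Perm (Fin (n + 1))} :
    IsCoxeterElement c ↔ ∃ ω : List (Fin n), IsCoxeterWord ω ∧ c = wordProd ω := by
  constructor
  · rintro ⟨w, rfl⟩
    exact ⟨List.ofFn w, ⟨List.nodup_ofFn.2 w.injective, fun i => by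
      rw [List.mem_ofFn]; exact w.surjective i⟩, rfl⟩
  · rintro ⟨ω, hω, rfl⟩
    refine ⟨(finCongr hω.length_eq.symm).trans (hω.1.getEquivOfForallMemList ω hω.2), ?_⟩
    congr 1
    exact List.ext_getElem (by simp [hω.length_eq]) fun k h1 h2 => by simp

theorem wordProd_nil {n : ℕ} : wordProd ([] : List (Fin n)) = 1 := rfl

theorem wordProd_cons {n : ℕ} (i : Fin n) (ω : List (Fin n)) :
    wordProd (i :: ω) = simpleReflection i * wordProd ω := by
  simp [wordProd]

theorem wordProd_append {n : ℕ} (ω ω' : List (Fin n)) :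
    wordProd (ω ++ ω') = wordProd ω * wordProd ω' := by
  simp [wordProd]

theorem simpleReflection_mul_wordProd_mul {n : ℕ} (i : Fin n) (ω : List (Fin n)) :
    simpleReflection i * wordProd (i :: ω) * simpleReflection i = wordProd (ω ++ [i]) := by
  rw [wordProd_cons, ← mul_assoc, simpleReflection_mul_self, one_mul, wordProd_append,
    wordProd_cons, wordProd_nil, mul_one]

theorem IsCoxeterWord.append_comm {n : ℕ} {ω ω' : List (Fin n)} (h : IsCoxeterWord (ω ++ ω')) :
    IsCoxeterWord (ω' ++ ω) :=
  ⟨List.nodup_append_comm.1 h.1, fun i => List.mem_append.2 (List.mem_append.1 (h.2 i)).symm⟩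

theorem permAct_wordProd_weight {n : ℕ} {i : Fin n} {ω : List (Fin n)} (h : i ∉ ω) :
    permAct (wordProd ω) (weight i) = weight i := by
  induction ω with
  | nil => rfl
  | cons j ω ih =>
    rw [List.mem_cons, not_or] at h
    rw [wordProd_cons, permAct_mul, ih h.2, permAct_simpleReflection_weight_of_ne (Ne.symm h.1)]

theorem permAct_injective {n : ℕ} (w : Equiv.Perm (Fin (n + 1))) :
    Function.Injective (permAct w) :=
  Function.LeftInverse.injective (permAct_inv_permAct w)

/-- Only the letter `i` moves the `i`-th weight, and a single occurrence cannot be undone. So the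
product of a repetition-free word remembers its letters. -/
theorem permAct_wordProd_weight_ne {n : ℕ} {i : Fin n} {ω : List (Fin n)} (hω : ω.Nodup)
    (hi : i ∈ ω) : permAct (wordProd ω) (weight i) ≠ weight i := by
  obtain ⟨u, v, rfl⟩ := List.append_of_mem hi
  rw [List.nodup_middle, List.nodup_cons, List.mem_append, not_or] at hω
  intro h
  rw [wordProd_append, wordProd_cons, permAct_mul, permAct_mul,
    permAct_wordProd_weight hω.1.2] at h
  have h2 := permAct_injective _ (h.trans (permAct_wordProd_weight hω.1.1).symm)
  rw [permAct_simpleReflection_weight, sub_eq_self] at h2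
  have h3 := simpleRoot_dotProduct_weight i i
  rw [h2] at h3
  simp at h3

/-- A missing letter would leave its weight fixed, so all `n` letters occur; the length bound then
excludes repetitions. Hence the reduced words of a Coxeter element are its Coxeter words. -/
theorem IsCoxeterWord.of_wordProd_eq {n : ℕ} {ω ω' : List (Fin n)} (hω : IsCoxeterWord ω)
    (h : wordProd ω' = wordProd ω) (hl : ω'.length ≤ n) : IsCoxeterWord ω' := by
  have hmem : ∀ i, i ∈ ω' := by
    intro i
    by_contra hi
    have := permAct_wordProd_weight hi
    rw [h] at this
    exact permAct_wordProd_weight_ne hω.1 (hω.2 i) this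
  refine ⟨?_, hmem⟩
  have huniv : ω'.toFinset = Finset.univ := Finset.eq_univ_iff_forall.2 fun i => by simp [hmem i]
  rw [← Multiset.coe_nodup, ← Multiset.toFinset_card_eq_card_iff_nodup]
  apply le_antisymm (Multiset.toFinset_card_le _)
  change ω'.length ≤ ω'.toFinset.card
  rwa [huniv, Finset.card_univ, Fintype.card_fin]

theorem IsCoxeterWord.le_length {n : ℕ} {ω ω' : List (Fin n)} (hω : IsCoxeterWord ω)
    (h : wordProd ω' = wordProd ω) : ω.length ≤ ω'.length := by
  rw [hω.length_eq]
  by_contra! hlt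
  exact hlt.ne (hω.of_wordProd_eq h hlt.le).length_eq

theorem IsCoxeterElement.isInitialIn_iff {n : ℕ} {c : Equiv.Perm (Fin (n + 1))}
    (hc : IsCoxeterElement c) {i : Fin n} :
    IsInitialIn i c ↔ ∃ ω : List (Fin n), IsCoxeterWord (i :: ω) ∧ c = wordProd (i :: ω) := by
  constructor
  · rintro ⟨ω, h1, h2⟩
    obtain ⟨ω', hω', rfl⟩ := isCoxeterElement_iff.1 hc
    exact ⟨ω, hω'.of_wordProd_eq h1 ((h2 ω' rfl).trans hω'.length_eq.le), h1.symm⟩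
  · rintro ⟨ω, hω, rfl⟩
    exact ⟨ω, rfl, fun ω' h => hω.le_length h⟩

theorem IsCoxeterElement.conj_of_isInitialIn {n : ℕ} {c : Equiv.Perm (Fin (n + 1))}
    (hc : IsCoxeterElement c) {i : Fin n} (hi : IsInitialIn i c) :
    IsCoxeterElement (simpleReflection i * c * simpleReflection i) := by
  obtain ⟨ω, hω, rfl⟩ := hc.isInitialIn_iff.1 hi
  exact isCoxeterElement_iff.2 ⟨ω ++ [i], hω.append_comm (ω := [i]),
    simpleReflection_mul_wordProd_mul i ω⟩

/-! ### The Euler form of a Coxeter element -/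

/-- Prepending `s_i` to `w` changes `v - w v` by a multiple of `α_i`, and `α_i` is itself obtained
from the `i`-th weight, so the error can be subtracted. -/
theorem exists_sub_permAct_eq_simpleRoot {n : ℕ} {ω : List (Fin n)} (hω : ω.Nodup) :
    ∀ j ∈ ω, ∃ v, v - permAct (wordProd ω) v = simpleRoot j := by
  induction ω with
  | nil => simp
  | cons i ω ih =>
    rw [List.nodup_cons] at hω
    have hi : weight i - permAct (wordProd (i :: ω)) (weight i) = simpleRoot i := by
      rw [wordProd_cons, permAct_mul, permAct_wordProd_weight hω.1,
        permAct_simpleReflection_weight, sub_sub_cancel]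
    intro j hj
    rcases List.mem_cons.1 hj with rfl | hj
    · exact ⟨_, hi⟩
    · obtain ⟨v, hv⟩ := ih hω.2 j hj
      refine ⟨v - (simpleRoot i ⬝ᵥ permAct (wordProd ω) v) • weight i, ?_⟩
      have h2 : v - permAct (wordProd (i :: ω)) v =
          simpleRoot j + (simpleRoot i ⬝ᵥ permAct (wordProd ω) v) • simpleRoot i := by
        rw [wordProd_cons, permAct_mul, permAct_simpleReflection, ← hv]
        abel
      rw [permAct_sub, permAct_smul, sub_sub_sub_comm, ← smul_sub, hi, h2, add_sub_cancel_right]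

theorem IsCoxeterElement.exists_sub_permAct_eq {n : ℕ} {c : Equiv.Perm (Fin (n + 1))}
    (hc : IsCoxeterElement c) {β : Fin (n + 1) → ℝ} (hβ : β ∈ almostPositiveRoots n) :
    ∃ v, v - permAct c v = β := by
  obtain ⟨ω, hω, rfl⟩ := isCoxeterElement_iff.1 hc
  choose v hv using fun j => exists_sub_permAct_eq_simpleRoot hω.1 j (hω.2 j)
  obtain ⟨a, rfl⟩ := exists_coeff_of_mem_almostPositiveRoots hβ
  refine ⟨∑ j, a j • v j, ?_⟩
  rw [permAct_sum, ← Finset.sum_sub_distrib]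
  exact Finset.sum_congr rfl fun j _ => by rw [permAct_smul, ← smul_sub, hv]

/-- The Euler form of `c` takes the value `r` at `(β, γ)`: writing `γ = u - c u`, the value
is `β · u`. -/
def EulerFormEq {n : ℕ} (c : Equiv.Perm (Fin (n + 1))) (β γ : Fin (n + 1) → ℝ) (r : ℝ) : Prop :=
  (∃ v, v - permAct c v = β) ∧ ∃ u, u - permAct c u = γ ∧ β ⬝ᵥ u = r

/-- Two choices of `u` differ by a `c`-fixed vector, and `β = v - c v` is orthogonal to fixed
vectors because `c` is orthogonal. -/
theorem EulerFormEq.unique {n : ℕ} {c : Equiv.Perm (Fin (n + 1))} {β γ : Fin (n + 1) → ℝ}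
    {r s : ℝ} (hr : EulerFormEq c β γ r) (hs : EulerFormEq c β γ s) : r = s := by
  obtain ⟨⟨v, hv⟩, u, hu, rfl⟩ := hr
  obtain ⟨-, u', hu', rfl⟩ := hs
  have h : permAct c (u - u') = u - u' := by
    rw [permAct_sub]
    exact (sub_eq_sub_iff_sub_eq_sub.1 (hu.trans hu'.symm)).symm
  rw [← sub_eq_zero, ← dotProduct_sub, ← hv, sub_dotProduct]
  conv_lhs => rw [← h]
  rw [permAct_dotProduct, h, ← permAct_dotProduct c v (u - u'), h, sub_self]

theorem IsCoxeterElement.exists_eulerFormEq {n : ℕ} {c : Equiv.Perm (Fin (n + 1))}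
    (hc : IsCoxeterElement c) {β γ : Fin (n + 1) → ℝ} (hβ : β ∈ almostPositiveRoots n)
    (hγ : γ ∈ almostPositiveRoots n) : ∃ r, EulerFormEq c β γ r := by
  obtain ⟨u, hu⟩ := hc.exists_sub_permAct_eq hγ
  exact ⟨_, hc.exists_sub_permAct_eq hβ, u, hu, rfl⟩

theorem EulerFormEq.conj {n : ℕ} {c : Equiv.Perm (Fin (n + 1))} {β γ : Fin (n + 1) → ℝ}
    {r : ℝ} (h : EulerFormEq c β γ r) (i : Fin n) :
    EulerFormEq (simpleReflection i * c * simpleReflection i)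
      (permAct (simpleReflection i) β) (permAct (simpleReflection i) γ) r := by
  have key : ∀ v, permAct (simpleReflection i) v -
      permAct (simpleReflection i * c * simpleReflection i) (permAct (simpleReflection i) v) =
        permAct (simpleReflection i) (v - permAct c v) := by
    intro v
    rw [← permAct_mul, mul_assoc, simpleReflection_mul_self, mul_one, permAct_mul, permAct_sub]
  obtain ⟨⟨v, rfl⟩, u, rfl, rfl⟩ := h
  exact ⟨⟨_, key v⟩, _, key u, permAct_dotProduct _ _ _⟩

theorem EulerFormEq.neg_right {n : ℕ} {c : Equiv.Perm (Fin (n + 1))} {β γ : Fin (n + 1) → ℝ}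
    {r : ℝ} (h : EulerFormEq c β γ r) : EulerFormEq c β (-γ) (-r) := by
  obtain ⟨⟨v, rfl⟩, u, rfl, rfl⟩ := h
  exact ⟨⟨v, rfl⟩, -u, by rw [permAct_neg]; abel, dotProduct_neg _ _⟩

/-- The symmetrization of the Euler form is the dot product, by `c u ⬝ᵥ c v = u ⬝ᵥ v`. -/
theorem EulerFormEq.symm {n : ℕ} {c : Equiv.Perm (Fin (n + 1))} {β γ : Fin (n + 1) → ℝ}
    {r : ℝ} (h : EulerFormEq c β γ r) : EulerFormEq c γ β (γ ⬝ᵥ β - r) := by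
  obtain ⟨⟨v, rfl⟩, u, rfl, rfl⟩ := h
  refine ⟨⟨u, rfl⟩, v, rfl, ?_⟩
  have h1 := permAct_dotProduct c u v
  rw [dotProduct_comm (v - permAct c v) u]
  simp only [sub_dotProduct, dotProduct_sub, h1]
  ring

/-- In a word starting with `i` the remaining letters fix `weight i`, so `c` sends it to `weight i -
α_i`. -/
theorem IsCoxeterElement.eulerFormEq_simpleRoot {n : ℕ} {c : Equiv.Perm (Fin (n + 1))}
    (hc : IsCoxeterElement c) {i : Fin n} (hi : IsInitialIn i c) {β : Fin (n + 1) → ℝ}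
    (hβ : β ∈ almostPositiveRoots n) : EulerFormEq c β (simpleRoot i) (β ⬝ᵥ weight i) := by
  refine ⟨hc.exists_sub_permAct_eq hβ, weight i, ?_, rfl⟩
  obtain ⟨ω, hω, rfl⟩ := hc.isInitialIn_iff.1 hi
  rw [wordProd_cons, permAct_mul, permAct_wordProd_weight (List.nodup_cons.1 hω.1).1,
    permAct_simpleReflection_weight, sub_sub_cancel]

/-! ### The compatibility family given by the Euler form -/

/-- Compatibility of almost positive roots in terms of the Euler form of `c`. -/
def EulerCompatible {n : ℕ} (c : Equiv.Perm (Fin (n + 1))) (β γ : Fin (n + 1) → ℝ) : Prop :=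
  IsCoxeterElement c ∧ β ∈ almostPositiveRoots n ∧ γ ∈ almostPositiveRoots n ∧ β ≠ γ ∧
    ((∃ i : Fin n, β = -simpleRoot i ∧ γ ⬝ᵥ weight i = 0) ∨
      (∃ i : Fin n, γ = -simpleRoot i ∧ β ⬝ᵥ weight i = 0) ∨
      (IsPositiveRoot β ∧ IsPositiveRoot γ ∧
        (∃ r, EulerFormEq c β γ r ∧ 0 ≤ r) ∧ ∃ r, EulerFormEq c γ β r ∧ 0 ≤ r))

theorem EulerCompatible.symm {n : ℕ} {c : Equiv.Perm (Fin (n + 1))} {β γ : Fin (n + 1) → ℝ}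
    (h : EulerCompatible c β γ) : EulerCompatible c γ β := by
  obtain ⟨hc, hβ, hγ, hne, h | h | h⟩ := h
  · exact ⟨hc, hγ, hβ, hne.symm, Or.inr (Or.inl h)⟩
  · exact ⟨hc, hγ, hβ, hne.symm, Or.inl h⟩
  · exact ⟨hc, hγ, hβ, hne.symm, Or.inr (Or.inr ⟨h.2.1, h.1, h.2.2.2, h.2.2.1⟩)⟩

theorem eulerCompatible_comm {n : ℕ} {c : Equiv.Perm (Fin (n + 1))} {β γ : Fin (n + 1) → ℝ} :
    EulerCompatible c β γ ↔ EulerCompatible c γ β :=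
  ⟨EulerCompatible.symm, EulerCompatible.symm⟩

theorem eulerCompatible_irrefl {n : ℕ} (c : Equiv.Perm (Fin (n + 1))) (β : Fin (n + 1) → ℝ) :
    ¬ EulerCompatible c β β :=
  fun h => h.2.2.2.1 rfl

theorem eulerCompatible_neg_simpleRoot_iff {n : ℕ} {c : Equiv.Perm (Fin (n + 1))}
    (hc : IsCoxeterElement c) (i : Fin n) {β : Fin (n + 1) → ℝ}
    (hβ : β ∈ almostPositiveRoots n) :
    EulerCompatible c (-simpleRoot i) β ↔ β ⬝ᵥ weight i = 0 := by
  constructor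
  · rintro ⟨-, -, -, hne, ⟨j, hj, h⟩ | ⟨j, rfl, -⟩ | h⟩
    · rwa [simpleRoot_injective (neg_injective hj)]
    · have hji : j ≠ i := fun h => hne (by rw [h])
      simp [simpleRoot_dotProduct_weight, hji]
    · exact absurd rfl (h.1.ne_neg_simpleRoot i)
  · intro h
    refine ⟨hc, neg_simpleRoot_mem i, hβ, ?_, Or.inl ⟨i, rfl, h⟩⟩
    rintro rfl
    simp [simpleRoot_dotProduct_weight] at h

theorem eulerCompatible_iff_of_isPositiveRoot {n : ℕ} {c : Equiv.Perm (Fin (n + 1))}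
    (hc : IsCoxeterElement c) {β γ : Fin (n + 1) → ℝ} (hβ : IsPositiveRoot β)
    (hγ : IsPositiveRoot γ) {r s : ℝ} (hr : EulerFormEq c β γ r) (hs : EulerFormEq c γ β s) :
    EulerCompatible c β γ ↔ β ≠ γ ∧ 0 ≤ r ∧ 0 ≤ s := by
  constructor
  · rintro ⟨-, -, -, hne, ⟨j, hj, h⟩ | ⟨j, hj, -⟩ | ⟨-, -, ⟨r', h1, h2⟩, s', h3, h4⟩⟩
    · exact absurd hj (hβ.ne_neg_simpleRoot j)
    · exact absurd hj (hγ.ne_neg_simpleRoot j)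
    · exact ⟨hne, hr.unique h1 ▸ h2, hs.unique h3 ▸ h4⟩
  · rintro ⟨hne, h1, h2⟩
    exact ⟨hc, hβ.mem, hγ.mem, hne, Or.inr (Or.inr ⟨hβ, hγ, ⟨r, hr, h1⟩, s, hs, h2⟩)⟩

theorem sigmaOp_dotProduct_weight_of_ne {n : ℕ} {i j : Fin n} (h : j ≠ i)
    {β : Fin (n + 1) → ℝ} (hβ : β ∈ almostPositiveRoots n) :
    sigmaOp i β ⬝ᵥ weight j = β ⬝ᵥ weight j := by
  obtain hβ | ⟨k, rfl⟩ := mem_almostPositiveRoots_iff.1 hβ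
  · rw [hβ.sigmaOp_eq, permAct_simpleReflection_dotProduct_weight_of_ne h.symm]
  · by_cases hk : k = i
    · subst hk
      simp [sigmaOp_neg_simpleRoot_self, simpleRoot_dotProduct_weight, h.symm]
    · rw [sigmaOp_neg_simpleRoot_of_ne hk]

/-- One Euler value is a coefficient of `γ`, hence nonnegative. The other is minus a coefficient of
the positive root `s_i γ`, so it is nonnegative only if that coefficient vanishes. -/
theorem eulerCompatible_simpleRoot_iff {n : ℕ} {c : Equiv.Perm (Fin (n + 1))}
    (hc : IsCoxeterElement c) {i : Fin n} (hi : IsInitialIn i c) {γ : Fin (n + 1) → ℝ}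
    (hγ : IsPositiveRoot γ) (hne : γ ≠ simpleRoot i) :
    EulerCompatible c (simpleRoot i) γ ↔
      permAct (simpleReflection i) γ ⬝ᵥ weight i = 0 := by
  have h1 := hc.eulerFormEq_simpleRoot hi hγ.mem
  have h2 := (hγ.permAct_simpleReflection hne).weight_nonneg i
  have h3 := hγ.weight_nonneg i
  have h4 : permAct (simpleReflection i) γ ⬝ᵥ weight i = γ ⬝ᵥ weight i - simpleRoot i ⬝ᵥ γ := by
    rw [permAct_simpleReflection, sub_dotProduct, smul_dotProduct, simpleRoot_dotProduct_weight]
    simp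
  rw [eulerCompatible_iff_of_isPositiveRoot hc (isPositiveRoot_simpleRoot i) hγ h1.symm h1]
  rw [h4] at h2 ⊢
  constructor
  · rintro ⟨-, h, -⟩
    linarith
  · intro h
    exact ⟨hne.symm, by linarith, h3⟩

/-- The mirror image of the previous lemma: after conjugation the critical value is minus a
coefficient of `γ` and the harmless one a coefficient of `s_i γ`. -/
theorem eulerCompatible_conj_simpleRoot_iff {n : ℕ} {c : Equiv.Perm (Fin (n + 1))}
    (hc : IsCoxeterElement c) {i : Fin n} (hi : IsInitialIn i c) {γ : Fin (n + 1) → ℝ}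
    (hγ : IsPositiveRoot γ) (hne : γ ≠ simpleRoot i) :
    EulerCompatible (simpleReflection i * c * simpleReflection i) (simpleRoot i)
      (permAct (simpleReflection i) γ) ↔ γ ⬝ᵥ weight i = 0 := by
  have h1 := (hc.eulerFormEq_simpleRoot hi hγ.mem).neg_right
  have h1' := h1.conj i
  have h2 := h1.symm.conj i
  rw [permAct_neg, permAct_simpleReflection_self, neg_neg] at h1' h2
  have hγ' := hγ.permAct_simpleReflection hne
  rw [eulerCompatible_iff_of_isPositiveRoot (hc.conj_of_isInitialIn hi)
    (isPositiveRoot_simpleRoot i) hγ' h2 h1']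
  have h2 := hγ'.weight_nonneg i
  have h3 := hγ.weight_nonneg i
  rw [permAct_simpleReflection, sub_dotProduct, smul_dotProduct,
    simpleRoot_dotProduct_weight, if_pos rfl, smul_eq_mul, mul_one] at h2
  rw [neg_dotProduct]
  constructor
  · rintro ⟨-, -, h⟩
    linarith
  · intro h
    refine ⟨fun he => ?_, by linarith, by linarith⟩
    have h5 := congrArg (permAct (simpleReflection i)) he
    rw [← permAct_mul, simpleReflection_mul_self, permAct_one,
      permAct_simpleReflection_self] at h5
    exact hγ.ne_neg_simpleRoot i h5.symm

theorem eulerCompatible_iff_sigmaOp {n : ℕ} {c : Equiv.Perm (Fin (n + 1))}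
    (hc : IsCoxeterElement c) {i : Fin n} (hi : IsInitialIn i c) {β γ : Fin (n + 1) → ℝ}
    (hβ : β ∈ almostPositiveRoots n) (hγ : γ ∈ almostPositiveRoots n) :
    EulerCompatible c β γ ↔
      EulerCompatible (simpleReflection i * c * simpleReflection i)
        (sigmaOp i β) (sigmaOp i γ) := by
  have hc' := hc.conj_of_isInitialIn hi
  have comm : ∀ {δ ε : Fin (n + 1) → ℝ}, (EulerCompatible c δ ε ↔
      EulerCompatible (simpleReflection i * c * simpleReflection i)
        (sigmaOp i δ) (sigmaOp i ε)) → (EulerCompatible c ε δ ↔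
      EulerCompatible (simpleReflection i * c * simpleReflection i)
        (sigmaOp i ε) (sigmaOp i δ)) := fun h => by
    rw [eulerCompatible_comm, h, eulerCompatible_comm]
  have hneg : ∀ {j : Fin n} {δ : Fin (n + 1) → ℝ}, j ≠ i → δ ∈ almostPositiveRoots n →
      (EulerCompatible c (-simpleRoot j) δ ↔
        EulerCompatible (simpleReflection i * c * simpleReflection i)
          (sigmaOp i (-simpleRoot j)) (sigmaOp i δ)) := fun hj hδ => by
    rw [sigmaOp_neg_simpleRoot_of_ne hj, eulerCompatible_neg_simpleRoot_iff hc _ hδ,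
      eulerCompatible_neg_simpleRoot_iff hc' _ (sigmaOp_mem i hδ),
      sigmaOp_dotProduct_weight_of_ne hj hδ]
  have hnegself : ∀ {δ : Fin (n + 1) → ℝ}, IsPositiveRoot δ →
      (EulerCompatible c (-simpleRoot i) δ ↔
        EulerCompatible (simpleReflection i * c * simpleReflection i)
          (sigmaOp i (-simpleRoot i)) (sigmaOp i δ)) := fun {δ} hδ => by
    rw [sigmaOp_neg_simpleRoot_self, eulerCompatible_neg_simpleRoot_iff hc _ hδ.mem]
    by_cases hi' : δ = simpleRoot i
    · rw [hi', sigmaOp_simpleRoot, eulerCompatible_comm,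
        eulerCompatible_neg_simpleRoot_iff hc' _ (isPositiveRoot_simpleRoot i).mem]
    · rw [hδ.sigmaOp_eq, eulerCompatible_conj_simpleRoot_iff hc hi hδ hi']
  have hsimple : ∀ {δ : Fin (n + 1) → ℝ}, IsPositiveRoot δ → δ ≠ simpleRoot i →
      (EulerCompatible c (simpleRoot i) δ ↔
        EulerCompatible (simpleReflection i * c * simpleReflection i)
          (sigmaOp i (simpleRoot i)) (sigmaOp i δ)) := fun hδ hne => by
    rw [sigmaOp_simpleRoot, eulerCompatible_neg_simpleRoot_iff hc' _ (sigmaOp_mem i hδ.mem),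
      eulerCompatible_simpleRoot_iff hc hi hδ hne, hδ.sigmaOp_eq]
  obtain hβ' | ⟨j, rfl⟩ := mem_almostPositiveRoots_iff.1 hβ
  · obtain hγ' | ⟨k, rfl⟩ := mem_almostPositiveRoots_iff.1 hγ
    · by_cases hβγ : β = γ
      · subst hβγ
        exact iff_of_false (eulerCompatible_irrefl _ _) (eulerCompatible_irrefl _ _)
      by_cases hβi : β = simpleRoot i
      · subst hβi
        exact hsimple hγ' (Ne.symm hβγ)
      by_cases hγi : γ = simpleRoot i
      · subst hγi
        exact comm (hsimple hβ' hβγ)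
      obtain ⟨r, hr⟩ := hc.exists_eulerFormEq hβ hγ
      rw [hβ'.sigmaOp_eq, hγ'.sigmaOp_eq,
        eulerCompatible_iff_of_isPositiveRoot hc hβ' hγ' hr hr.symm,
        eulerCompatible_iff_of_isPositiveRoot hc' (hβ'.permAct_simpleReflection hβi)
          (hγ'.permAct_simpleReflection hγi) (hr.conj i) (hr.symm.conj i),
        (permAct_injective _).ne_iff]
    · by_cases hk : k = i
      · subst hk
        exact comm (hnegself hβ')
      · exact comm (hneg hk hβ)
  · by_cases hj : j = i
    · subst hj
      obtain hγ' | ⟨k, rfl⟩ := mem_almostPositiveRoots_iff.1 hγ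
      · exact hnegself hγ'
      · by_cases hk : k = j
        · subst hk
          exact iff_of_false (eulerCompatible_irrefl _ _) (eulerCompatible_irrefl _ _)
        · exact comm (hneg hk hβ)
    · exact hneg hj hγ

theorem isCompatibilityFamily_eulerCompatible (n : ℕ) :
    IsCompatibilityFamily n EulerCompatible where
  supported _ _ _ h := ⟨h.1, h.2.1, h.2.2.1⟩
  symmetric _ _ _ h := h.symm
  neg_simple _ hc i _ hβ := by
    rw [exists_coeff_eq_zero_iff hβ, eulerCompatible_neg_simpleRoot_iff hc i hβ]
  initial_step _ hc _ hi _ hβ _ hγ := eulerCompatible_iff_sigmaOp hc hi hβ hγ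

/-! ### Uniqueness of the compatibility family -/

/-- Any two compatibility families agree on which roots are `c`-compatible with `β`. -/
def CompatibilityDetermined {n : ℕ} (c : Equiv.Perm (Fin (n + 1))) (β : Fin (n + 1) → ℝ) :
    Prop :=
  ∀ R R', IsCompatibilityFamily n R → IsCompatibilityFamily n R' →
    ∀ γ ∈ almostPositiveRoots n, R c β γ ↔ R' c β γ

theorem compatibilityDetermined_neg_simpleRoot {n : ℕ} {c : Equiv.Perm (Fin (n + 1))}
    (hc : IsCoxeterElement c) (i : Fin n) : CompatibilityDetermined c (-simpleRoot i) :=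
  fun _ _ hR hR' γ hγ => by rw [hR.neg_simple c hc i γ hγ, hR'.neg_simple c hc i γ hγ]

theorem CompatibilityDetermined.of_sigmaOp {n : ℕ} {c : Equiv.Perm (Fin (n + 1))}
    (hc : IsCoxeterElement c) {i : Fin n} (hi : IsInitialIn i c) {β : Fin (n + 1) → ℝ}
    (hβ : β ∈ almostPositiveRoots n)
    (h : CompatibilityDetermined (simpleReflection i * c * simpleReflection i) (sigmaOp i β)) :
    CompatibilityDetermined c β := fun R R' hR hR' γ hγ => by
  rw [hR.initial_step c hc i hi β hβ γ hγ, hR'.initial_step c hc i hi β hβ γ hγ,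
    h R R' hR hR' _ (sigmaOp_mem i hγ)]

/-- Each step of (2) moves the first letter to the end and reflects the root. An undetermined root
never equals the simple root of the current letter, since it would become negative simple and be
settled by (1); so it stays positive. -/
theorem not_compatibilityDetermined_rotate {n : ℕ} (ω : List (Fin n)) :
    ∀ (ω' : List (Fin n)) (β : Fin (n + 1) → ℝ), IsCoxeterWord (ω ++ ω') → IsPositiveRoot β →
      ¬ CompatibilityDetermined (wordProd (ω ++ ω')) β →
      IsPositiveRoot (permAct (wordProd ω)⁻¹ β) ∧
        ¬ CompatibilityDetermined (wordProd (ω' ++ ω)) (permAct (wordProd ω)⁻¹ β) := by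
  induction ω with
  | nil =>
    intro ω' β _ hβ h
    rw [List.append_nil]
    exact ⟨hβ, h⟩
  | cons i ω ih =>
    intro ω' β hω hβ h
    rw [List.cons_append] at hω h
    have hc : IsCoxeterElement (wordProd (i :: (ω ++ ω'))) := isCoxeterElement_iff.2 ⟨_, hω, rfl⟩
    have hi : IsInitialIn i (wordProd (i :: (ω ++ ω'))) := hc.isInitialIn_iff.2 ⟨_, hω, rfl⟩
    have h1 := fun h' => h (CompatibilityDetermined.of_sigmaOp hc hi hβ.mem h')
    have hβi : β ≠ simpleRoot i := by
      rintro rfl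
      rw [sigmaOp_simpleRoot] at h1
      exact h1 (compatibilityDetermined_neg_simpleRoot (hc.conj_of_isInitialIn hi) i)
    rw [hβ.sigmaOp_eq, simpleReflection_mul_wordProd_mul, List.append_assoc] at h1
    have hω' : IsCoxeterWord (ω ++ (ω' ++ [i])) := by
      rw [← List.append_assoc]
      exact hω.append_comm (ω := [i])
    have h2 := ih _ _ hω' (hβ.permAct_simpleReflection hβi) h1
    rw [wordProd_cons, mul_inv_rev, permAct_mul, simpleReflection_inv]
    rwa [List.append_assoc, List.singleton_append] at h2

theorem compatibilityDetermined {n : ℕ} {c : Equiv.Perm (Fin (n + 1))}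
    (hc : IsCoxeterElement c) {β : Fin (n + 1) → ℝ} (hβ : β ∈ almostPositiveRoots n) :
    CompatibilityDetermined c β := by
  obtain hpos | ⟨i, rfl⟩ := mem_almostPositiveRoots_iff.1 hβ
  swap
  · exact compatibilityDetermined_neg_simpleRoot hc i
  by_contra hdet
  have hiter : ∀ k : ℕ, IsPositiveRoot (permAct (c⁻¹ ^ k) β) ∧
      ¬ CompatibilityDetermined c (permAct (c⁻¹ ^ k) β) := by
    obtain ⟨ω, hω, rfl⟩ := isCoxeterElement_iff.1 hc
    intro k
    induction k with
    | zero => exact ⟨hpos, hdet⟩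
    | succ k ih =>
      have := not_compatibilityDetermined_rotate ω [] _ (by rwa [List.append_nil]) ih.1
        (by rw [List.append_nil]; exact ih.2)
      rwa [List.nil_append, ← permAct_mul, ← pow_succ'] at this
  obtain ⟨v, hv⟩ := hc.exists_sub_permAct_eq hβ
  -- With `β = v - c v` the orbit sum telescopes and closes up at the order of `c`.
  have hsum : ∑ k ∈ Finset.range (orderOf c), permAct (c⁻¹ ^ (k + 1)) β = 0 := by
    have : ∀ k, permAct (c⁻¹ ^ (k + 1)) β =
        permAct (c⁻¹ ^ (k + 1)) v - permAct (c⁻¹ ^ k) v := by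
      intro k
      rw [← hv, permAct_sub, ← permAct_mul _ c, pow_succ, mul_assoc, inv_mul_cancel, mul_one]
    rw [Finset.sum_congr rfl fun k _ => this k, Finset.sum_range_sub fun k => permAct (c⁻¹ ^ k) v,
      inv_pow, pow_orderOf_eq_one, inv_one, pow_zero, sub_self]
  obtain ⟨i, hi⟩ := (hiter 0).1.exists_weight_eq_one
  have h0 : (∑ k ∈ Finset.range (orderOf c), permAct (c⁻¹ ^ (k + 1)) β) ⬝ᵥ weight i = 0 := by
    rw [hsum, zero_dotProduct]
  rw [sum_dotProduct, Finset.sum_eq_zero_iff_of_nonneg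
    fun k _ => (hiter (k + 1)).1.weight_nonneg i] at h0
  have hN := orderOf_pos c
  -- The last term of the sum is `β` itself, because its exponent is the order of `c`.
  have h1 := h0 (orderOf c - 1) (Finset.mem_range.2 (by omega))
  rw [Nat.sub_add_cancel hN, inv_pow, pow_orderOf_eq_one, inv_one] at h1
  rw [pow_zero, h1] at hi
  exact zero_ne_one hi

theorem existsUnique_isCompatibilityFamily (n : ℕ) : ∃! R, IsCompatibilityFamily n R := by
  refine ⟨EulerCompatible, isCompatibilityFamily_eulerCompatible n, fun R hR => ?_⟩
  have hE := isCompatibilityFamily_eulerCompatible n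
  funext c β γ
  refine propext ⟨fun h => ?_, fun h => ?_⟩
  · obtain ⟨hc, hβ, hγ⟩ := hR.supported c β γ h
    exact (compatibilityDetermined hc hβ R _ hR hE γ hγ).1 h
  · exact (compatibilityDetermined h.1 h.2.1 R _ hR hE γ h.2.2.1).2 h

theorem cCompatible_iff {n : ℕ} {c : Equiv.Perm (Fin (n + 1))} {β γ : Fin (n + 1) → ℝ} :
    CCompatible c β γ ↔ EulerCompatible c β γ := by
  constructor
  · rintro ⟨R, hR, h⟩
    rwa [(existsUnique_isCompatibilityFamily n).unique hR
      (isCompatibilityFamily_eulerCompatible n)] at h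
  · exact fun h => ⟨_, isCompatibilityFamily_eulerCompatible n, h⟩

/-! ### Compatibility for the linear Coxeter element -/

theorem wordProd_apply_of_forall_ne {n : ℕ} {ω : List (Fin n)} {x : Fin (n + 1)}
    (h : ∀ j ∈ ω, x ≠ j.castSucc ∧ x ≠ j.succ) : wordProd ω x = x := by
  induction ω with
  | nil => rfl
  | cons i ω ih =>
    rw [List.forall_mem_cons] at h
    rw [wordProd_cons, Equiv.Perm.mul_apply, ih h.2, simpleReflection,
      Equiv.swap_apply_of_ne_of_ne h.1.1 h.1.2]

/-- The rightmost letters act first: those after `k` do not touch position `k`, the letter `k` moves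
it one up, and those before `k` do not touch the new position. -/
theorem linearCoxeterElement_castSucc {n : ℕ} (k : Fin n) :
    linearCoxeterElement n k.castSucc = k.succ := by
  obtain ⟨u, v, huv⟩ := List.append_of_mem (List.mem_finRange k)
  have hp := List.pairwise_lt_finRange n
  rw [huv, List.pairwise_append] at hp
  obtain ⟨-, hv, hu⟩ := hp
  rw [List.pairwise_cons] at hv
  have h1 : wordProd v k.castSucc = k.castSucc := by
    refine wordProd_apply_of_forall_ne fun j hj => ?_
    have := hv.1 j hj
    simp only [ne_eq, Fin.ext_iff, Fin.val_castSucc, Fin.val_succ]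
    omega
  have h2 : wordProd u k.succ = k.succ := by
    refine wordProd_apply_of_forall_ne fun j hj => ?_
    have := hu j hj k List.mem_cons_self
    simp only [ne_eq, Fin.ext_iff, Fin.val_castSucc, Fin.val_succ]
    omega
  rw [linearCoxeterElement, huv, wordProd_append, wordProd_cons, Equiv.Perm.mul_apply,
    Equiv.Perm.mul_apply, h1, simpleReflection, Equiv.swap_apply_left, h2]

theorem isCoxeterElement_linearCoxeterElement (n : ℕ) :
    IsCoxeterElement (linearCoxeterElement n) :=
  isCoxeterElement_iff.2 ⟨_, ⟨List.nodup_finRange n, List.mem_finRange⟩, rfl⟩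

theorem sum_Icc_single_castSucc_apply {n : ℕ} (a b : Fin n) (x : Fin (n + 1)) :
    (∑ k ∈ Finset.Icc a b, Pi.single k.castSucc 1 : Fin (n + 1) → ℝ) x =
      if a.val ≤ x.val ∧ x.val ≤ b.val then 1 else 0 := by
  rw [Finset.sum_apply]
  refine Fin.lastCases ?_ (fun y => ?_) x
  -- The last coordinate is no `castSucc`, so it gets no contribution.
  · have : ¬ n ≤ b.val := by omega
    rw [Finset.sum_eq_zero]
    · simp [this]
    · intro k _
      exact Pi.single_eq_of_ne (Fin.castSucc_lt_last k).ne' _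
  · simp only [Pi.single_apply, Fin.castSucc_inj, Finset.sum_ite_eq, Finset.mem_Icc,
      Fin.val_castSucc, Fin.le_def]

/-- Since `α_k = e_k - c e_k`, the vector `u` is the indicator of the second interval. The first
root is `e_a - e_{b+1}`, so it reads that indicator at `a` and `b + 1`. -/
theorem eulerFormEq_linearCoxeterElement {n : ℕ} {a b : Fin n} (h : a ≤ b) (a' b' : Fin n) :
    EulerFormEq (linearCoxeterElement n) (∑ k ∈ Finset.Icc a b, simpleRoot k)
      (∑ k ∈ Finset.Icc a' b', simpleRoot k)
      ((if a'.val ≤ a.val ∧ a.val ≤ b'.val then 1 else 0) -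
        (if a'.val ≤ b.val + 1 ∧ b.val + 1 ≤ b'.val then 1 else 0)) := by
  have key : ∀ a b : Fin n, (∑ k ∈ Finset.Icc a b, Pi.single k.castSucc 1) -
      permAct (linearCoxeterElement n) (∑ k ∈ Finset.Icc a b, Pi.single k.castSucc 1) =
        ∑ k ∈ Finset.Icc a b, simpleRoot k := by
    intro a b
    rw [permAct_sum, ← Finset.sum_sub_distrib]
    refine Finset.sum_congr rfl fun k _ => ?_
    rw [permAct_single, linearCoxeterElement_castSucc]
    rfl
  refine ⟨⟨_, key a b⟩, _, key a' b', ?_⟩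
  rw [sum_Icc_simpleRoot h, sub_dotProduct, single_one_dotProduct, single_one_dotProduct,
    sum_Icc_single_castSucc_apply, sum_Icc_single_castSucc_apply]
  rfl

/-- The first Euler value is negative exactly when `a < a' ≤ b + 1 ≤ b'`, that is, when the
intervals cross or abut; the other value covers the opposite order. -/
theorem eulerCompatible_linearCoxeterElement_iff {n : ℕ} {a b a' b' : Fin n} (h : a ≤ b)
    (h' : a' ≤ b')
    (hne : ∑ k ∈ Finset.Icc a b, simpleRoot k ≠ ∑ k ∈ Finset.Icc a' b', simpleRoot k) :
    EulerCompatible (linearCoxeterElement n) (∑ k ∈ Finset.Icc a b, simpleRoot k)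
        (∑ k ∈ Finset.Icc a' b', simpleRoot k) ↔
      (a'.val ≤ a.val ∧ b.val ≤ b'.val) ∨ (a.val ≤ a'.val ∧ b'.val ≤ b.val) ∨
        b.val + 1 < a'.val ∨ b'.val + 1 < a.val := by
  have hsub : ∀ (p q : Prop) [Decidable p] [Decidable q],
      (0 : ℝ) ≤ (if p then 1 else 0) - (if q then 1 else 0) ↔ (q → p) := by
    intro p q _ _
    by_cases hp : p <;> by_cases hq : q <;> simp [hp, hq]
  rw [eulerCompatible_iff_of_isPositiveRoot (isCoxeterElement_linearCoxeterElement n)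
    (isPositiveRoot_iff_exists_Icc.2 ⟨a, b, h, rfl⟩)
    (isPositiveRoot_iff_exists_Icc.2 ⟨a', b', h', rfl⟩)
    (eulerFormEq_linearCoxeterElement h a' b') (eulerFormEq_linearCoxeterElement h' a b),
    hsub, hsub, and_iff_right hne]
  rw [Fin.le_def] at h h'
  omega

/-! ### Tubes of the single path hypercube graph -/

/-- The tube `{a, a + 1, …, b}` of the single path hypercube graph. -/
def intervalTube {n : ℕ} (a b : Fin n) : Finset (SignedIndex n) :=
  (Finset.Icc a b).map Function.Embedding.inl

theorem inl_mem_intervalTube {n : ℕ} {a b k : Fin n} :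
    (Sum.inl k : SignedIndex n) ∈ intervalTube a b ↔ a ≤ k ∧ k ≤ b := by
  simp [intervalTube]

theorem inr_notMem_intervalTube {n : ℕ} {a b k : Fin n} :
    (Sum.inr k : SignedIndex n) ∉ intervalTube a b := by
  simp [intervalTube]

theorem singlePath_adj_inl {n : ℕ} {i j : Fin n} :
    (singlePath n).graph.Adj (Sum.inl i) (Sum.inl j) ↔
      i.val + 1 = j.val ∨ j.val + 1 = i.val := by
  constructor
  · rintro ⟨i', j', hi, hj, h⟩
    rwa [Sum.inl_injective hi, Sum.inl_injective hj]
  · exact fun h => ⟨i, j, rfl, rfl, h⟩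

theorem not_singlePath_adj_inr_left {n : ℕ} {i : Fin n} {x : SignedIndex n} :
    ¬ (singlePath n).graph.Adj (Sum.inr i) x := by
  rintro ⟨i', j', hi, -⟩
  simp at hi

theorem SimpleGraph.Reachable.induction_adj {V : Type*} {G : SimpleGraph V} {p : V → Prop}
    (hp : ∀ x y, G.Adj x y → p x → p y) {u v : V} (h : G.Reachable u v) (hu : p u) : p v := by
  obtain ⟨w⟩ := h
  induction w with
  | nil => exact hu
  | cons hadj _ ih => exact ih (hp _ _ hadj hu)

theorem isTube_singleton_inr {n : ℕ} (i : Fin n) :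
    IsTube (singlePath n) {Sum.inr i} := by
  constructor
  · intro a ha
    rw [Finset.mem_singleton] at ha
    simp [ha]
  · rw [SimpleGraph.connected_iff_exists_forall_reachable]
    refine ⟨⟨Sum.inr i, by simp⟩, ?_⟩
    rintro ⟨x, hx⟩
    have : x = Sum.inr i := by simpa using hx
    subst this
    exact SimpleGraph.Reachable.refl _

theorem isTube_intervalTube {n : ℕ} {a b : Fin n} (h : a ≤ b) :
    IsTube (singlePath n) (intervalTube a b) := by
  constructor
  · rintro (k | k) hk
    · exact inr_notMem_intervalTube
    · exact absurd hk inr_notMem_intervalTube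
  · rw [SimpleGraph.connected_iff_exists_forall_reachable]
    refine ⟨⟨Sum.inl a, Finset.mem_coe.2 (inl_mem_intervalTube.2 ⟨le_rfl, h⟩)⟩, ?_⟩
    have key : ∀ (m : ℕ) (k : Fin n) (hk : (Sum.inl k : SignedIndex n) ∈
        (intervalTube a b : Set (SignedIndex n))), k.val = a.val + m →
        ((singlePath n).graph.induce (intervalTube a b : Set (SignedIndex n))).Reachable
          ⟨Sum.inl a, Finset.mem_coe.2 (inl_mem_intervalTube.2 ⟨le_rfl, h⟩)⟩
          ⟨Sum.inl k, hk⟩ := by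
      intro m
      induction m with
      | zero =>
        intro k hk hm
        have : k = a := Fin.ext hm
        subst this
        exact SimpleGraph.Reachable.refl _
      | succ m ih =>
        intro k hk hm
        have hk' := inl_mem_intervalTube.1 (Finset.mem_coe.1 hk)
        rw [Fin.le_def, Fin.le_def] at hk'
        have hl : (Sum.inl ⟨a.val + m, by omega⟩ : SignedIndex n) ∈
            (intervalTube a b : Set (SignedIndex n)) := by
          refine Finset.mem_coe.2 (inl_mem_intervalTube.2 ?_)
          rw [Fin.le_def, Fin.le_def]
          dsimp only
          omega
        refine (ih _ hl rfl).trans (SimpleGraph.Adj.reachable ?_)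
        exact singlePath_adj_inl.2 (Or.inl (by dsimp only; omega))
    rintro ⟨k | k, hk⟩
    · have hk' := inl_mem_intervalTube.1 (Finset.mem_coe.1 hk)
      rw [Fin.le_def] at hk'
      exact key (k.val - a.val) k hk (by omega)
    · exact absurd (Finset.mem_coe.1 hk) inr_notMem_intervalTube

/-- Negative indices are isolated vertices, so a tube containing one is a singleton. Any other tube
fills the range between its extremes, since a walk in a path cannot jump over a missing vertex. -/
theorem IsTube.eq_intervalTube_or_eq_singleton {n : ℕ} {t : Finset (SignedIndex n)}
    (ht : IsTube (singlePath n) t) :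
    (∃ a b : Fin n, a ≤ b ∧ t = intervalTube a b) ∨ ∃ i : Fin n, t = {Sum.inr i} := by
  have hconn := ht.2.preconnected
  by_cases hr : ∃ i : Fin n, Sum.inr i ∈ t
  · obtain ⟨i, hi⟩ := hr
    refine Or.inr ⟨i, Finset.eq_singleton_iff_unique_mem.2 ⟨hi, fun x hx => ?_⟩⟩
    refine (hconn ⟨Sum.inr i, hi⟩ ⟨x, hx⟩).induction_adj (p := fun y => y.1 = Sum.inr i) ?_ rfl
    rintro ⟨y, _⟩ ⟨z, _⟩ hyz hy
    change y = _ at hy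
    subst hy
    exact absurd hyz not_singlePath_adj_inr_left
  · push Not at hr
    left
    let s : Finset (Fin n) := Finset.univ.filter fun k => Sum.inl k ∈ t
    have hs : s.Nonempty := by
      obtain ⟨⟨k | k, hk⟩⟩ := ht.2.nonempty
      · exact ⟨k, by simpa [s] using hk⟩
      · exact absurd hk (hr k)
    have hmem : ∀ k, k ∈ s ↔ Sum.inl k ∈ t := fun k => by simp [s]
    have ha := (hmem _).1 (s.min'_mem hs)
    have hb := (hmem _).1 (s.max'_mem hs)
    refine ⟨s.min' hs, s.max' hs, s.min'_le _ (s.max'_mem hs), ?_⟩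
    ext (k | k)
    · rw [inl_mem_intervalTube]
      constructor
      · intro hk
        exact ⟨s.min'_le _ ((hmem k).2 hk), s.le_max' _ ((hmem k).2 hk)⟩
      · rintro ⟨h1, h2⟩
        by_contra hk
        -- If `k` were missing, a walk starting at the minimum would stay below `k`, so the maximum
        -- would too.
        have hlt : ∃ j : Fin n, (Sum.inl (s.max' hs) : SignedIndex n) = Sum.inl j ∧ j < k := by
          refine (hconn ⟨_, ha⟩ ⟨_, hb⟩).induction_adj
            (p := fun y => ∃ j : Fin n, y.1 = Sum.inl j ∧ j < k) ?_ ⟨_, rfl, ?_⟩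
          · rintro ⟨y, hy⟩ ⟨z, hz⟩ hyz ⟨j, hj, hjk⟩
            change y = _ at hj
            subst hj
            obtain z | z := z
            · refine ⟨z, rfl, ?_⟩
              have hzk : z ≠ k := by
                rintro rfl
                exact hk hz
              have := singlePath_adj_inl.1 hyz
              rw [ne_eq, Fin.ext_iff] at hzk
              rw [Fin.lt_def] at hjk ⊢
              omega
            · exact absurd hz (hr z)
          · refine lt_of_le_of_ne h1 ?_
            intro h
            exact hk (h ▸ ha)
        obtain ⟨j, hj, hjk⟩ := hlt
        rw [← Sum.inl_injective hj] at hjk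
        exact not_lt.2 h2 hjk
    · exact iff_of_false (hr k) inr_notMem_intervalTube

theorem WeaklyCompatible.symm {n : ℕ} {G : HypercubeGraph n} {t u : Finset (SignedIndex n)}
    (h : WeaklyCompatible G t u) : WeaklyCompatible G u t := by
  obtain h | h | ⟨h1, h2⟩ := h
  · exact Or.inr (Or.inl h)
  · exact Or.inl h
  · exact Or.inr (Or.inr ⟨h1.symm, fun a ha b hb hab => h2 b hb a ha hab.symm⟩)

theorem weaklyCompatible_intervalTube_iff {n : ℕ} {a b a' b' : Fin n} (h : a ≤ b)
    (h' : a' ≤ b') :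
    WeaklyCompatible (singlePath n) (intervalTube a b) (intervalTube a' b') ↔
      (a'.val ≤ a.val ∧ b.val ≤ b'.val) ∨ (a.val ≤ a'.val ∧ b'.val ≤ b.val) ∨
        b.val + 1 < a'.val ∨ b'.val + 1 < a.val := by
  have hsub : ∀ {a b a' b' : Fin n}, a ≤ b →
      (intervalTube a b ⊆ intervalTube a' b' ↔ a'.val ≤ a.val ∧ b.val ≤ b'.val) := by
    intro a b a' b' h
    rw [intervalTube, intervalTube, Finset.map_subset_map, Finset.Icc_subset_Icc_iff h]
    rfl
  rw [WeaklyCompatible, hsub h, hsub h']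
  refine or_congr_right (or_congr_right' fun hn => ?_)
  rw [Fin.le_def] at h h'
  constructor
  · rintro ⟨hd, hadj⟩
    by_contra! hcon
    have hmem : ∀ k : Fin n, ¬ (a.val ≤ k.val ∧ k.val ≤ b.val ∧ a'.val ≤ k.val ∧
        k.val ≤ b'.val) := fun k hk =>
      Finset.disjoint_left.1 hd (inl_mem_intervalTube.2 ⟨hk.1, hk.2.1⟩)
        (inl_mem_intervalTube.2 hk.2.2)
    have hadj' : ∀ k l : Fin n, a.val ≤ k.val → k.val ≤ b.val → a'.val ≤ l.val →
        l.val ≤ b'.val → ¬ (k.val + 1 = l.val ∨ l.val + 1 = k.val) :=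
      fun k l h1 h2 h3 h4 h5 => hadj _ (inl_mem_intervalTube.2 ⟨h1, h2⟩) _
        (inl_mem_intervalTube.2 ⟨h3, h4⟩) (singlePath_adj_inl.2 h5)
    -- Two intersecting intervals share a left end, and two abutting ones are joined by an edge
    -- between facing ends; these four instances suffice.
    have h1 := hmem a
    have h2 := hmem a'
    have h3 := hadj' b a'
    have h4 := hadj' a b'
    omega
  · intro hsep
    constructor
    · rw [Finset.disjoint_left]
      rintro (k | k) hk hk'
      · rw [inl_mem_intervalTube, Fin.le_def, Fin.le_def] at hk hk'
        omega
      · exact inr_notMem_intervalTube hk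
    · rintro (k | k) hk (l | l) hl hkl
      · rw [inl_mem_intervalTube, Fin.le_def, Fin.le_def] at hk hl
        rw [singlePath_adj_inl] at hkl
        omega
      · exact inr_notMem_intervalTube hl
      · exact inr_notMem_intervalTube hk
      · exact inr_notMem_intervalTube hk

theorem weaklyCompatible_singleton_inr {n : ℕ} {i : Fin n} {t : Finset (SignedIndex n)}
    (h : Sum.inr i ∉ t) : WeaklyCompatible (singlePath n) {Sum.inr i} t := by
  refine Or.inr (Or.inr ⟨Finset.disjoint_singleton_left.2 h, fun a ha b _ => ?_⟩)
  rw [Finset.mem_singleton.1 ha]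
  exact not_singlePath_adj_inr_left

/-! ### The linear map sending the standard basis to the simple roots -/

/-- The linear map with `e_i ↦ α_i`. -/
noncomputable def rootMap (n : ℕ) : (Fin n → ℝ) →ₗ[ℝ] (Fin (n + 1) → ℝ) :=
  Fintype.linearCombination ℝ simpleRoot

theorem rootMap_single {n : ℕ} (i : Fin n) : rootMap n (Pi.single i 1) = simpleRoot i := by
  rw [rootMap, Fintype.linearCombination_apply_single, one_smul]

theorem rootMap_injective (n : ℕ) : Function.Injective (rootMap n) := by
  intro x y h
  funext i
  rw [← sum_smul_simpleRoot_dotProduct_weight x i, ← sum_smul_simpleRoot_dotProduct_weight y i]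
  exact congrArg (· ⬝ᵥ weight i) h

theorem range_rootMap (n : ℕ) : (rootMap n).range = rootSpace n := by
  rw [rootMap, Fintype.range_linearCombination]
  apply le_antisymm
  · refine Submodule.span_mono ?_
    rintro _ ⟨i, rfl⟩
    exact (isPositiveRoot_simpleRoot i).mem.1
  · have hpos : ∀ β : Fin (n + 1) → ℝ, IsPositiveRoot β →
        β ∈ Submodule.span ℝ (Set.range (simpleRoot (n := n))) := by
      intro β hβ
      obtain ⟨a, b, -, rfl⟩ := isPositiveRoot_iff_exists_Icc.1 hβ
      exact Submodule.sum_mem _ fun k _ => Submodule.subset_span ⟨k, rfl⟩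
    refine Submodule.span_le.2 ?_
    rintro _ ⟨i, j, hij, rfl⟩
    rcases lt_or_gt_of_ne hij with h | h
    · exact hpos _ ⟨i, j, h, rfl⟩
    · rw [← neg_sub]
      exact Submodule.neg_mem _ (hpos _ ⟨j, i, h, rfl⟩)

/-- The linear isomorphism from `ℝⁿ` onto the span of the roots with `e_i ↦ α_i`. -/
noncomputable def rootEquiv (n : ℕ) : (Fin n → ℝ) ≃ₗ[ℝ] rootSpace n :=
  (LinearEquiv.ofInjective (rootMap n) (rootMap_injective n)).trans
    (LinearEquiv.ofEq _ _ (range_rootMap n))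

theorem subtype_comp_rootEquiv (n : ℕ) :
    (rootSpace n).subtype ∘ₗ (rootEquiv n).toLinearMap = rootMap n := rfl

theorem rootMap_tubeVector_intervalTube {n : ℕ} (a b : Fin n) :
    rootMap n (tubeVector (intervalTube a b)) = ∑ k ∈ Finset.Icc a b, simpleRoot k := by
  rw [tubeVector, intervalTube, Finset.sum_map, map_sum]
  exact Finset.sum_congr rfl fun k _ => rootMap_single k

theorem rootMap_tubeVector_singleton_inr {n : ℕ} (i : Fin n) :
    rootMap n (tubeVector {Sum.inr i}) = -simpleRoot i := by
  rw [tubeVector, Finset.sum_singleton, cubeNormal, map_neg, rootMap_single]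

theorem IsTube.rootMap_tubeVector_mem {n : ℕ} {t : Finset (SignedIndex n)}
    (ht : IsTube (singlePath n) t) : rootMap n (tubeVector t) ∈ almostPositiveRoots n := by
  obtain ⟨a, b, h, rfl⟩ | ⟨i, rfl⟩ := ht.eq_intervalTube_or_eq_singleton
  · rw [rootMap_tubeVector_intervalTube]
    exact (isPositiveRoot_iff_exists_Icc.2 ⟨a, b, h, rfl⟩).mem
  · rw [rootMap_tubeVector_singleton_inr]
    exact neg_simpleRoot_mem i

theorem exists_isTube_rootMap_tubeVector_eq {n : ℕ} {β : Fin (n + 1) → ℝ}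
    (hβ : β ∈ almostPositiveRoots n) :
    ∃ t, IsTube (singlePath n) t ∧ rootMap n (tubeVector t) = β := by
  obtain h | ⟨i, rfl⟩ := mem_almostPositiveRoots_iff.1 hβ
  · obtain ⟨a, b, hab, rfl⟩ := isPositiveRoot_iff_exists_Icc.1 h
    exact ⟨_, isTube_intervalTube hab, rootMap_tubeVector_intervalTube a b⟩
  · exact ⟨_, isTube_singleton_inr i, rootMap_tubeVector_singleton_inr i⟩

/-! ### Comparison of the fans -/

/-- The graph imposes nothing here. Vanishing of the coefficient at `α_i` means that `i` is outside
the interval, which is the cube-face condition on the union. -/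
theorem eulerCompatible_singleton_intervalTube_iff {n : ℕ} (i : Fin n) {a b : Fin n}
    (h : a ≤ b) :
    EulerCompatible (linearCoxeterElement n) (rootMap n (tubeVector {Sum.inr i}))
        (rootMap n (tubeVector (intervalTube a b))) ↔
      WeaklyCompatible (singlePath n) {Sum.inr i} (intervalTube a b) ∧
        ∀ x ∈ ({Sum.inr i} : Finset (SignedIndex n)), x.swap ∉ intervalTube a b := by
  rw [and_iff_right (weaklyCompatible_singleton_inr inr_notMem_intervalTube),
    rootMap_tubeVector_singleton_inr, eulerCompatible_neg_simpleRoot_iff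
      (isCoxeterElement_linearCoxeterElement n) i (isTube_intervalTube h).rootMap_tubeVector_mem,
    rootMap_tubeVector_intervalTube, sum_dotProduct]
  simp [simpleRoot_dotProduct_weight, inl_mem_intervalTube]

/-- The dictionary between tubes and roots. Distinctness is needed because a tube is weakly
compatible with itself, while no root is compatible with itself. -/
theorem IsTube.eulerCompatible_iff {n : ℕ} {t u : Finset (SignedIndex n)}
    (ht : IsTube (singlePath n) t) (hu : IsTube (singlePath n) u)
    (hne : rootMap n (tubeVector t) ≠ rootMap n (tubeVector u)) :
    EulerCompatible (linearCoxeterElement n) (rootMap n (tubeVector t))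
        (rootMap n (tubeVector u)) ↔
      WeaklyCompatible (singlePath n) t u ∧ ∀ x ∈ t, x.swap ∉ u := by
  obtain ⟨a, b, h, rfl⟩ | ⟨i, rfl⟩ := ht.eq_intervalTube_or_eq_singleton
  · obtain ⟨a', b', h', rfl⟩ | ⟨j, rfl⟩ := hu.eq_intervalTube_or_eq_singleton
    · have hswap : ∀ x ∈ intervalTube a b, x.swap ∉ intervalTube a' b' := by
        rintro (k | k) hk
        · exact inr_notMem_intervalTube
        · exact absurd hk inr_notMem_intervalTube
      rw [rootMap_tubeVector_intervalTube, rootMap_tubeVector_intervalTube] at hne ⊢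
      rw [and_iff_left hswap, weaklyCompatible_intervalTube_iff h h',
        eulerCompatible_linearCoxeterElement_iff h h' hne]
    · rw [eulerCompatible_comm, eulerCompatible_singleton_intervalTube_iff j h]
      refine and_congr ⟨WeaklyCompatible.symm, WeaklyCompatible.symm⟩
        ⟨fun hs x hx hx' => ?_, fun hs x hx hx' => ?_⟩
      · exact hs _ hx' (by rwa [Sum.swap_swap])
      · exact hs _ hx' (by rwa [Sum.swap_swap])
  · obtain ⟨a', b', h', rfl⟩ | ⟨j, rfl⟩ := hu.eq_intervalTube_or_eq_singleton
    · exact eulerCompatible_singleton_intervalTube_iff i h'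
    · have hij : i ≠ j := by
        rintro rfl
        exact hne rfl
      refine iff_of_true ?_ ⟨weaklyCompatible_singleton_inr (by simpa using hij), by simp⟩
      rw [rootMap_tubeVector_singleton_inr, rootMap_tubeVector_singleton_inr,
        eulerCompatible_neg_simpleRoot_iff (isCoxeterElement_linearCoxeterElement n) i
          (neg_simpleRoot_mem j), neg_dotProduct, simpleRoot_dotProduct_weight, if_neg hij.symm,
        neg_zero]

theorem image_conicHull {E E' : Type*} [AddCommGroup E] [Module ℝ E] [AddCommGroup E']
    [Module ℝ E'] (f : E →ₗ[ℝ] E') (S : Set E) : f '' conicHull S = conicHull (f '' S) :=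
  congrArg SetLike.coe (Submodule.map_span (f.restrictScalars NNReal) S)

theorem mapFan_tubingFan_singlePath (n : ℕ) :
    mapFan (rootMap n) (tubingFan (singlePath n)) = clusterFan (linearCoxeterElement n) := by
  classical
  ext D
  constructor
  · rintro ⟨_, ⟨T, ⟨hT, hw, hface⟩, rfl⟩, rfl⟩
    refine ⟨T.image fun t => rootMap n (tubeVector t), ?_, ?_, ?_⟩
    · intro β hβ
      obtain ⟨t, ht, rfl⟩ := Finset.mem_image.1 hβ
      exact (hT t ht).rootMap_tubeVector_mem
    · intro β hβ γ hγ hne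
      obtain ⟨t, ht, rfl⟩ := Finset.mem_image.1 hβ
      obtain ⟨u, hu, rfl⟩ := Finset.mem_image.1 hγ
      rw [cCompatible_iff, (hT t ht).eulerCompatible_iff (hT u hu) hne]
      exact ⟨hw t ht u hu, fun x hx hx' => hface x (Finset.mem_sup.2 ⟨t, ht, hx⟩)
        (Finset.mem_sup.2 ⟨u, hu, hx'⟩)⟩
    · rw [image_conicHull, Finset.coe_image, Set.image_image]
  · rintro ⟨S, hS, hc, rfl⟩
    -- One tube per root is enough to rebuild the cone, so the tubing is the image of `S` under this
    -- choice.
    choose! t ht hteq using fun β (hβ : β ∈ S) => exists_isTube_rootMap_tubeVector_eq (hS β hβ)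
    have hcompat : ∀ β ∈ S, ∀ γ ∈ S, β ≠ γ → WeaklyCompatible (singlePath n) (t β) (t γ) ∧
        ∀ x ∈ t β, x.swap ∉ t γ := by
      intro β hβ γ hγ hne
      rw [← (ht β hβ).eulerCompatible_iff (ht γ hγ) (by rwa [hteq β hβ, hteq γ hγ]),
        hteq β hβ, hteq γ hγ, ← cCompatible_iff]
      exact hc β hβ γ hγ hne
    refine ⟨_, ⟨S.image t, ⟨?_, ?_, ?_⟩, rfl⟩, ?_⟩
    · intro u hu
      obtain ⟨β, hβ, rfl⟩ := Finset.mem_image.1 hu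
      exact ht β hβ
    · intro u hu v hv
      obtain ⟨β, hβ, rfl⟩ := Finset.mem_image.1 hu
      obtain ⟨γ, hγ, rfl⟩ := Finset.mem_image.1 hv
      by_cases hne : β = γ
      · rw [hne]
        exact Or.inl subset_rfl
      · exact (hcompat β hβ γ hγ hne).1
    -- The union condition is pairwise: an index and its negative lie in two tubes of the family, or
    -- in one, which is itself a cube face.
    · intro x hx hx'
      obtain ⟨u, hu, hxu⟩ := Finset.mem_sup.1 hx
      obtain ⟨v, hv, hxv⟩ := Finset.mem_sup.1 hx'
      obtain ⟨β, hβ, rfl⟩ := Finset.mem_image.1 hu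
      obtain ⟨γ, hγ, rfl⟩ := Finset.mem_image.1 hv
      by_cases hne : β = γ
      · rw [← hne] at hxv
        exact (ht β hβ).1 x hxu hxv
      · exact (hcompat β hβ γ hγ hne).2 x hxu hxv
    · rw [image_conicHull, Finset.coe_image, Set.image_image, Set.image_image]
      congr 1
      exact ((Set.image_congr hteq).trans (Set.image_id' _)).symm

theorem mainTheorem6 (n : ℕ) :
    (∃! R, IsCompatibilityFamily n R) ∧
    ∃ h : (Fin n → ℝ) ≃ₗ[ℝ] rootSpace n,
      (∀ i : Fin n, (h (Pi.single i 1) : Fin (n + 1) → ℝ) = simpleRoot i) ∧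
      mapFan ((rootSpace n).subtype ∘ₗ h.toLinearMap) (tubingFan (singlePath n)) =
        clusterFan (linearCoxeterElement n) ∧
      ∀ P : Set (Fin n → ℝ), IsStandardCutAssociahedron (singlePath n) P →
        mapFan ((rootSpace n).subtype ∘ₗ h.toLinearMap) (normalFan P) =
          clusterFan (linearCoxeterElement n) := by
  refine ⟨existsUnique_isCompatibilityFamily n, rootEquiv n, rootMap_single, ?_, fun P hP => ?_⟩
  · rw [subtype_comp_rootEquiv, mapFan_tubingFan_singlePath]
  · rw [hP.2, subtype_comp_rootEquiv, mapFan_tubingFan_singlePath]
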